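/- Let $\mathbb R^{n+1}_1$ be $\mathbb R^{n+1}$ with $\langle x,y\rangle=-x_0y_0+\sum_{i=1}^n x_iy_i$, with $e_0=(1,0,\dots,0)$ future directed. Let $s+k=n+1$, let $U\subset\mathbb R^s$ be open, let $X:U\to\mathbb R^{n+1}_1$ be a smooth spacelike embedding (of codimension $k$), $M=X(U)$, and let $N_p(M)=(T_pM)^\perp$. For a smooth future directed unit timelike normal vector field $n^T$ along $M$ and $p=X(u)$ put $$N_1(M)_p[n^T]=\{\xi\in N_p(M)\mid \langle\xi,\xi\rangle=1,\ \langle\xi,n^T(u)\rangle=0\},$$ the unit sphere of the $(k-1)$-dimensional spacelike space $N_p(M)\cap n^T(u)^\perp$, with its Riemannian volume $d\sigma_{k-2}(n^T)$ (counting measure if $k=2$; the sphere is empty if $k=1$), and let $N_1(M)[n^T]$ be the bundle of these spheres over $M$. The lightcone Gauss map is $\widetilde{\mathbb{LG}}(n^T)(p,\xi)=\widetilde{n^T(u)+\xi}$, where $\widetilde x=(1,x_1/x_0,\dots,x_n/x_0)$. The normalized lightcone Lipschitz-Killing curvature is $$\widetilde K_\ell(n^T)(p,\xi)=\det\bigl(-\Pi^\tau\circ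 d_{(p,\xi)}\widetilde{\mathbb{LG}}(n^T)\bigr),$$ where $T_{(p,\xi)}N_1(M)[n^T]$ is identified with $T_pM\oplus T_\xi N_1(M)_p[n^T]\subset\mathbb R^{n+1}_1$ and $\Pi^\tau$ is the orthogonal projection onto that subspace with respect to $\langle\cdot,\cdot\rangle$. Let $n^T$ and $\bar n^T$ be two smooth future directed unit timelike normal vector fields along $M$, and let $p=X(u)\in M$. Then: (1) There is a bijection $\Phi:N_1(M)_p[n^T]\to N_1(M)_p[\bar n^T]$ with $\widetilde{\mathbb{LG}}(\bar n^T)(p,\Phi(\xi))=\widetilde{\mathbb{LG}}(n^T)(p,\xi)$ for all $\xi$, and it carries $|\widetilde K_\ell(n^T)|\,d\sigma_{k-2}(n^T)$ to $|\widetilde K_\ell(\bar n^T)|\,d\sigma_{k-2}(\bar n^T)$: for every Borel set $A\subset N_1(M)_p[n^T]$, $$\int_A|\widetilde K_\ell(n^T)(p,\xi)|\,d\sigma_{k-2}(n^T)=\int_{\Phi(A)}|\widetilde K_\ell(\bar n^T)(p,\bar\xi)|\,d\sigma_{k-2}(\bar n^T).$$ (2) Both $|\widetilde K_\ell(n^T)(p,\cdot)|$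 and $|\widetilde K_\ell(\bar n^T)(p,\cdot)|$ are integrable over their fibers, and $$\int_{N_1(M)_p[n^T]}|\widetilde K_\ell(n^T)(p,\xi)|\,d\sigma_{k-2}(n^T)=\int_{N_1(M)_p[\bar n^T]}|\widetilde K_\ell(\bar n^T)(p,\bar\xi)|\,d\sigma_{k-2}(\bar n^T).$$ Hence the total absolute lightcone curvature $K^*_\ell(p)$, defined as this integral, does not depend on the choice of $n^T$. -/

import Mathlib

open MeasureTheory
open scoped ContDiff

namespace LorentzMinkowski

/-- The vector space underlying Lorentz-Minkowski `(n+1)`-space; the coordinate `x 0` is time. -/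
abbrev Mink (n : ℕ) : Type := Fin (n + 1) → ℝ

/-- The pseudo scalar product `⟨x, y⟩ = -x₀y₀ + x₁y₁ + ⋯ + xₙyₙ`. -/
noncomputable def form (n : ℕ) : LinearMap.BilinForm ℝ (Mink n) :=
  LinearMap.mk₂ ℝ (fun x y => -(x 0 * y 0) + ∑ i : Fin n, x i.succ * y i.succ)
    (fun x x' y => by simp only [Pi.add_apply, add_mul, Finset.sum_add_distrib]; ring)
    (fun c x y => by
      simp only [Pi.smul_apply, smul_eq_mul, mul_add, Finset.mul_sum, mul_assoc]; ring)
    (fun x y y' => by simp only [Pi.add_apply, mul_add, Finset.sum_add_distrib]; ring)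
    (fun c x y => by
      simp only [Pi.smul_apply, smul_eq_mul, mul_add, Finset.mul_sum, mul_left_comm c]; ring)

/-- The parameter space `ℝˢ`. -/
abbrev Param (s : ℕ) : Type := EuclideanSpace ℝ (Fin s)

/-- The partial derivative `X_{u_i}(u)`. -/
noncomputable def partialDeriv {s n : ℕ} (X : Param s → Mink n) (i : Fin s) (u : Param s) :
    Mink n :=
  fderiv ℝ X u (EuclideanSpace.single i 1)

/-- The tangent space `T_pM` at `p = X(u)`, spanned by the `X_{u_i}(u)`. -/
noncomputable def tangentSpace {s n : ℕ} (X : Param s → Mink n) (u : Param s) :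
    Submodule ℝ (Mink n) :=
  Submodule.span ℝ (Set.range fun i => partialDeriv X i u)

/-- The pseudo-normal space `N_p(M)` at `p = X(u)`. -/
noncomputable def normalSpace {s n : ℕ} (X : Param s → Mink n) (u : Param s) :
    Submodule ℝ (Mink n) :=
  (form n).orthogonal (tangentSpace X u)

/-- A smooth spacelike embedding `X : U → ℝ₁ⁿ⁺¹` of an open set `U ⊆ ℝˢ`. -/
structure IsSpacelikeEmbedding {s n : ℕ} (U : Set (Param s)) (X : Param s → Mink n) : Prop where
  isOpen : IsOpen U
  smooth : ContDiffOn ℝ ∞ X U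
  isEmbedding : Topology.IsEmbedding (U.domRestrict X)
  immersive : ∀ u ∈ U, Function.Injective (fderiv ℝ X u)
  spacelike : ∀ u ∈ U, ∀ v ∈ tangentSpace X u, v ≠ 0 → 0 < form n v v

/-- A smooth future directed unit timelike normal vector field `nT` along `M = X(U)`,
written as a function of the parameter. The future is the side of `e₀ = (1, 0, …, 0)`. -/
structure IsFutureUnitTimelikeNormal {s n : ℕ} (U : Set (Param s)) (X : Param s → Mink n)
    (nT : Param s → Mink n) : Prop where
  smooth : ContDiffOn ℝ ∞ nT U
  normal : ∀ u ∈ U, nT u ∈ normalSpace X u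
  unit : ∀ u ∈ U, form n (nT u) (nT u) = -1
  future : ∀ u ∈ U, 0 < nT u 0

/-- The spacelike subspace `N_p(M) ∩ ⟨nT(u)⟩^⊥` of dimension `k - 1`, at `p = X(u)`. -/
noncomputable def spacelikeNormalSpace {s n : ℕ} (X nT : Param s → Mink n) (u : Param s) :
    Submodule ℝ (Mink n) :=
  normalSpace X u ⊓ (form n).orthogonal (Submodule.span ℝ {nT u})

/-- The fibre `N₁(M)_p[nT]` over `p = X(u)`: unit vectors of `N_p(M)` orthogonal to `nT(u)`. -/
def fiber {s n : ℕ} (X nT : Param s → Mink n) (u : Param s) : Set (Mink n) :=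
  {ξ | ξ ∈ spacelikeNormalSpace X nT u ∧ form n ξ ξ = 1}

/-- `f` is a pseudo-orthonormal basis (all vectors of square `1`) of the subspace `W`. -/
def IsOrthonormalFrame {n m : ℕ} (W : Submodule ℝ (Mink n)) (f : Fin m → Mink n) : Prop :=
  (∀ i j, form n (f i) (f j) = if i = j then 1 else 0) ∧ Submodule.span ℝ (Set.range f) = W

open Classical in
/-- The Riemannian volume measure of the unit sphere `S^{m-1}` of an `m`-dimensional spacelike
subspace `W`, as a measure on the ambient space. It is the image of the surface measure of the
unit sphere of `ℝᵐ` (counting measure on two points if `m = 1`) under the linear isometry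
`ℝᵐ → W` given by an orthonormal frame of `W`; since the surface measure is invariant under
`O(m)`, it does not depend on the frame. -/
noncomputable def sphereMeasure {n : ℕ} (m : ℕ) (W : Submodule ℝ (Mink n)) :
    Measure (Mink n) :=
  if h : ∃ f : Fin m → Mink n, IsOrthonormalFrame W f then
    Measure.map
      (fun x : Metric.sphere (0 : EuclideanSpace ℝ (Fin m)) 1 => ∑ i, x.1 i • h.choose i)
      (volume : Measure (EuclideanSpace ℝ (Fin m))).toSphere
  else 0

/-- The volume element `dσ_{k-2}(nT)` of the fibre `N₁(M)_p[nT]`, where `k` is the codimension. -/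
noncomputable def fiberMeasure {s n : ℕ} (k : ℕ) (X nT : Param s → Mink n) (u : Param s) :
    Measure (Mink n) :=
  sphereMeasure (k - 1) (spacelikeNormalSpace X nT u)

/-- `x ↦ x̃ = (1, x₁/x₀, …, xₙ/x₀)`. -/
noncomputable def normalize {n : ℕ} (x : Mink n) : Mink n := (x 0)⁻¹ • x

/-- The lightcone Gauss map `(u, ξ) ↦ (nT(u) + ξ)~`; it is restricted to the bundle
`N₁(M)[nT]` where it is used. -/
noncomputable def lightconeGauss {s n : ℕ} (nT : Param s → Mink n) (q : Param s × Mink n) :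
    Mink n :=
  normalize (nT q.1 + q.2)

/-- Defining equations of `N₁(M)[nT]` in `U × ℝ₁ⁿ⁺¹` (with `M` identified with `U`): the bundle
consists of the `(u, ξ)` that are mapped to `(1, 0, 0)`. -/
noncomputable def bundleEquations {s n : ℕ} (X nT : Param s → Mink n) (q : Param s × Mink n) :
    ℝ × ℝ × (Fin s → ℝ) :=
  (form n q.2 q.2, form n q.2 (nT q.1), fun i => form n q.2 (partialDeriv X i q.1))

/-- The tangent space of `N₁(M)[nT]` at `(u, ξ)`: the kernel of the differential of its defining
equations, a subspace of `ℝˢ × ℝ₁ⁿ⁺¹`. -/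
noncomputable def bundleTangent {s n : ℕ} (X nT : Param s → Mink n) (u : Param s) (ξ : Mink n) :
    Submodule ℝ (Param s × Mink n) :=
  LinearMap.ker (fderiv ℝ (bundleEquations X nT) (u, ξ)).toLinearMap

/-- The tangent space at `ξ` of the fibre `N₁(M)_p[nT]`. -/
noncomputable def fiberTangent {s n : ℕ} (X nT : Param s → Mink n) (u : Param s) (ξ : Mink n) :
    Submodule ℝ (Mink n) :=
  spacelikeNormalSpace X nT u ⊓ (form n).orthogonal (Submodule.span ℝ {ξ})

/-- `T_pM ⊕ T_ξ S^{k-2}`, as a subspace of `T_p ℝ₁ⁿ⁺¹`. -/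
noncomputable def splitTangent {s n : ℕ} (X nT : Param s → Mink n) (u : Param s) (ξ : Mink n) :
    Submodule ℝ (Mink n) :=
  tangentSpace X u ⊔ fiberTangent X nT u ξ

open Classical in
/-- The orthogonal projection, for the pseudo scalar product, onto a subspace `W` on which it is
nondegenerate (and `0` for the other subspaces). -/
noncomputable def orthProj {n : ℕ} (W : Submodule ℝ (Mink n)) : Mink n →ₗ[ℝ] W :=
  if h : IsCompl W ((form n).orthogonal W) then
    Submodule.projectionOnto W ((form n).orthogonal W) h
  else 0

/-- The canonical identification `T_{(p,ξ)} N₁(M)[nT] → T_pM ⊕ T_ξ S^{k-2}`: a tangent vector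
`(w, ζ)` goes to `dX_u(w)` plus the component of `ζ` tangent to the fibre. (This sum lies in
`T_pM ⊕ T_ξ S^{k-2}`; the outer projection only records that fact in the type.) -/
noncomputable def canonicalIdent {s n : ℕ} (X nT : Param s → Mink n) (u : Param s) (ξ : Mink n) :
    bundleTangent X nT u ξ →ₗ[ℝ] splitTangent X nT u ξ :=
  orthProj (splitTangent X nT u ξ) ∘ₗ
    ((fderiv ℝ X u).toLinearMap ∘ₗ LinearMap.fst ℝ (Param s) (Mink n) +
      (fiberTangent X nT u ξ).subtype ∘ₗ orthProj (fiberTangent X nT u ξ) ∘ₗ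
        LinearMap.snd ℝ (Param s) (Mink n)) ∘ₗ
    (bundleTangent X nT u ξ).subtype

open Classical in
/-- The inverse of the canonical identification (it is bijective at every point of `N₁(M)[nT]`). -/
noncomputable def canonicalIdentInv {s n : ℕ} (X nT : Param s → Mink n) (u : Param s)
    (ξ : Mink n) : splitTangent X nT u ξ →ₗ[ℝ] bundleTangent X nT u ξ :=
  if h : Function.Bijective (canonicalIdent X nT u ξ) then
    (LinearEquiv.ofBijective (canonicalIdent X nT u ξ) h).symm.toLinearMap
  else 0

/-- The normalized lightcone Lipschitz-Killing curvature
`K̃_ℓ(nT)(p, ξ) = det (-Π^τ ∘ d_{(p,ξ)} LG̃(nT))` at `p = X(u)`, where the differential of the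
lightcone Gauss map of `N₁(M)[nT]` is read on `T_pM ⊕ T_ξ S^{k-2} = T_{(p,ξ)} N₁(M)[nT]`. -/
noncomputable def lipschitzKilling {s n : ℕ} (X nT : Param s → Mink n) (u : Param s)
    (ξ : Mink n) : ℝ :=
  LinearMap.det
    (-(orthProj (splitTangent X nT u ξ) ∘ₗ
      (fderiv ℝ (lightconeGauss nT) (u, ξ)).toLinearMap ∘ₗ
      (bundleTangent X nT u ξ).subtype ∘ₗ canonicalIdentInv X nT u ξ))

/-- The total absolute lightcone curvature `K*_ℓ(p)`, `p = X(u)`, computed with `nT`: the integral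
of `|K̃_ℓ(nT)(p, ξ)|` over the fibre. -/
noncomputable def totalAbsCurvature {s n : ℕ} (k : ℕ) (X nT : Param s → Mink n) (u : Param s) :
    ℝ :=
  ∫ ξ in fiber X nT u, |lipschitzKilling X nT u ξ| ∂(fiberMeasure k X nT u)

end LorentzMinkowski

namespace LorentzMinkowski

variable {n : ℕ}

theorem form_apply (x y : Mink n) :
    form n x y = -(x 0 * y 0) + ∑ i : Fin n, x i.succ * y i.succ := rfl

theorem form_comm (x y : Mink n) : form n x y = form n y x := by
  simp only [form_apply, mul_comm]

theorem form_isRefl : (form n).IsRefl := fun x y h => by rw [form_comm]; exact h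

theorem form_nondegenerate : (form n).Nondegenerate := by
  refine (LinearMap.IsRefl.nondegenerate_iff_separatingLeft form_isRefl).2 fun x hx => ?_
  funext i
  refine Fin.cases ?_ (fun j => ?_) i
  · simpa [form_apply] using hx (Pi.single 0 1)
  · have := hx (Pi.single j.succ 1)
    simpa [form_apply, Pi.single_apply] using this

theorem mem_orthogonal_span_singleton {x y : Mink n} :
    y ∈ (form n).orthogonal (Submodule.span ℝ {x}) ↔ form n x y = 0 := by
  refine ⟨fun h => h x (Submodule.mem_span_singleton_self x), fun h z hz => ?_⟩
  obtain ⟨c, rfl⟩ := Submodule.mem_span_singleton.1 hz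
  rw [map_smul, LinearMap.smul_apply, h, smul_zero]

/-- The pseudo scalar product is positive definite on the complement of a unit timelike vector. -/
theorem form_pos_of_orthogonal {ν v : Mink n} (hν : form n ν ν = -1) (h : form n ν v = 0)
    (hv : v ≠ 0) : 0 < form n v v := by
  have hcs := Finset.sum_mul_sq_le_sq_mul_sq Finset.univ (fun i : Fin n => ν i.succ)
    (fun i => v i.succ)
  simp only [form_apply, ← sq] at *
  set S := ∑ i : Fin n, ν i.succ ^ 2
  set V := ∑ i : Fin n, v i.succ ^ 2 with hV
  set P := ∑ i : Fin n, ν i.succ * v i.succ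
  have hP : P = ν 0 * v 0 := by linarith
  have hS : S = ν 0 ^ 2 - 1 := by linarith
  have hV0 : 0 ≤ V := Finset.sum_nonneg fun i _ => sq_nonneg _
  have hS0 : 0 ≤ S := Finset.sum_nonneg fun i _ => sq_nonneg _
  by_contra! hle
  have hVt : V ≤ v 0 ^ 2 := by linarith
  have h1 : S * V ≤ S * v 0 ^ 2 := mul_le_mul_of_nonneg_left hVt hS0
  have h2 : v 0 ^ 2 ≤ 0 := by
    rw [hP] at hcs; rw [hS] at h1 hcs; nlinarith
  have h3 : V = 0 := le_antisymm (hVt.trans h2) hV0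
  apply hv
  funext i
  refine Fin.cases ?_ (fun j => ?_) i
  · simpa using le_antisymm h2 (sq_nonneg _)
  · have := (Finset.sum_eq_zero_iff_of_nonneg (fun i _ => sq_nonneg _)).1 h3 j (Finset.mem_univ _)
    simpa using this

/-- Future directed causal vectors have negative product with future directed timelike vectors. -/
theorem form_neg_of_future {x y : Mink n} (hx : form n x x ≤ 0) (hx0 : 0 < x 0)
    (hy : form n y y < 0) (hy0 : 0 < y 0) : form n x y < 0 := by
  have hcs := Finset.sum_mul_sq_le_sq_mul_sq Finset.univ (fun i : Fin n => x i.succ)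
    (fun i => y i.succ)
  simp only [form_apply, ← sq] at *
  set S := ∑ i : Fin n, x i.succ ^ 2
  set V := ∑ i : Fin n, y i.succ ^ 2
  set P := ∑ i : Fin n, x i.succ * y i.succ
  have hV0 : 0 ≤ V := Finset.sum_nonneg fun i _ => sq_nonneg _
  have h1 : S * V ≤ x 0 ^ 2 * V := mul_le_mul_of_nonneg_right (by linarith) hV0
  have h2 : x 0 ^ 2 * V < x 0 ^ 2 * y 0 ^ 2 := mul_lt_mul_of_pos_left (by linarith) (by positivity)
  have h3 : P < x 0 * y 0 := by
    apply lt_of_pow_lt_pow_left₀ 2 (by positivity)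
    rw [mul_pow]; linarith
  linarith

/-- The null vector `ν + ξ` is future directed. -/
theorem time_add_pos {ν ξ : Mink n} (hν : form n ν ν = -1) (hν0 : 0 < ν 0)
    (h : form n ν ξ = 0) (hξ : form n ξ ξ = 1) : 0 < ν 0 + ξ 0 := by
  have hcs := Finset.sum_mul_sq_le_sq_mul_sq Finset.univ (fun i : Fin n => ν i.succ)
    (fun i => ξ i.succ)
  simp only [form_apply, ← sq] at *
  set S := ∑ i : Fin n, ν i.succ ^ 2
  set V := ∑ i : Fin n, ξ i.succ ^ 2
  set P := ∑ i : Fin n, ν i.succ * ξ i.succ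
  have hP : P = ν 0 * ξ 0 := by linarith
  have hS : S = ν 0 ^ 2 - 1 := by linarith
  have hV : V = 1 + ξ 0 ^ 2 := by linarith
  rw [hP, hS, hV] at hcs
  have := abs_lt_of_sq_lt_sq (show ξ 0 ^ 2 < ν 0 ^ 2 by nlinarith) hν0.le
  linarith [(abs_lt.1 this).1]

theorem isCompl_orthogonal {ν : Mink n} (hν : form n ν ν = -1) {W : Submodule ℝ (Mink n)}
    (hW : ∀ w ∈ W, form n ν w = 0) : IsCompl W ((form n).orthogonal W) := by
  rw [LinearMap.BilinForm.isCompl_orthogonal_iff_disjoint form_isRefl, Submodule.disjoint_def]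
  intro w hw hw'
  by_contra h0
  exact (form_pos_of_orthogonal hν (hW w hw) h0).ne' (hw' w hw)

theorem exists_orthonormalFrame {ν : Mink n} (hν : form n ν ν = -1) {W : Submodule ℝ (Mink n)}
    (hW : ∀ w ∈ W, form n ν w = 0) {m : ℕ} (hm : Module.finrank ℝ W = m) :
    ∃ f : Fin m → Mink n, IsOrthonormalFrame W f := by
  subst hm
  obtain ⟨v, hv⟩ := LinearMap.BilinForm.exists_orthogonal_basis
    (B := (form n).restrict W) ⟨fun x y => form_comm x.1 y.1⟩
  have hpos : ∀ i, 0 < form n (v i) (v i) := fun i =>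
    form_pos_of_orthogonal hν (hW _ (v i).2) (by simpa using v.ne_zero i)
  have hu : ∀ i, IsUnit (√(form n (v i) (v i)))⁻¹ := fun i =>
    (inv_ne_zero (Real.sqrt_pos.2 (hpos i)).ne').isUnit
  refine ⟨fun i => (v.isUnitSMul hu i : W), fun i j => ?_, ?_⟩
  · simp only [Module.Basis.isUnitSMul_apply, Submodule.coe_smul, map_smul, LinearMap.smul_apply,
      smul_eq_mul]
    split_ifs with h
    · subst h
      have := Real.mul_self_sqrt (hpos i).le
      have h0 := (Real.sqrt_pos.2 (hpos i)).ne'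
      field_simp
      rw [sq, this]
    · have : form n (v i) (v j) = 0 := hv h
      rw [this, mul_zero, mul_zero]
  · have h := congrArg (Submodule.map W.subtype) (v.isUnitSMul hu).span_eq
    rwa [Submodule.map_span, ← Set.range_comp, Submodule.map_subtype_top] at h

theorem finrank_orthogonal_add (W : Submodule ℝ (Mink n)) :
    Module.finrank ℝ ((form n).orthogonal W) + Module.finrank ℝ W = n + 1 := by
  have h := LinearMap.BilinForm.finrank_orthogonal form_nondegenerate W
  have h' := Submodule.finrank_le W
  rw [Module.finrank_fin_fun] at h h'
  omega

section Sphere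

open scoped Pointwise ENNReal RealInnerProductSpace

variable {E : Type*} [NormedAddCommGroup E] [InnerProductSpace ℝ E]

theorem hasFDerivAt_norm_of_ne_zero {x : E} (hx : x ≠ 0) :
    HasFDerivAt (fun y : E => ‖y‖) (innerSL ℝ (‖x‖⁻¹ • x)) x := by
  have h := (hasStrictFDerivAt_norm_sq x).hasFDerivAt.sqrt (by simpa using hx)
  simp only [Real.sqrt_sq (norm_nonneg _)] at h
  refine h.congr_fderiv ?_
  have := norm_ne_zero_iff.2 hx
  ext v
  simp
  field_simp

variable [FiniteDimensional ℝ E]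

/-- The determinant of a linear map that is, up to isometries, the identity on a line and
multiplication by `s` on its orthogonal complement. -/
theorem abs_det_of_inner_eq {A : E →ₗ[ℝ] E} {e : E} (he : ‖e‖ = 1) {s : ℝ} (hs : 0 < s)
    (hA : ∀ v w, ⟪A v, A w⟫ = s ^ 2 * ⟪v, w⟫ + (1 - s ^ 2) * (⟪e, v⟫ * ⟪e, w⟫)) :
    |LinearMap.det A| = s ^ (Module.finrank ℝ E - 1) := by
  set o := stdOrthonormalBasis ℝ E
  set d := Module.finrank ℝ E with hd
  have hdpos : 0 < d := Module.finrank_pos_iff_exists_ne_zero.2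
    ⟨e, fun h => by simp [h] at he⟩
  set M := LinearMap.toMatrix o.toBasis o.toBasis A with hM
  set w : Fin d → ℝ := fun i => ⟪e, o i⟫
  have hentry : ∀ i j, M i j = ⟪o i, A (o j)⟫ := fun i j => by
    simp [hM, LinearMap.toMatrix_apply, OrthonormalBasis.repr_apply_apply]
  have hMM : M.transpose * M = s ^ 2 • (1 + Matrix.replicateCol Unit (((1 - s ^ 2) / s ^ 2) • w)
      * Matrix.replicateRow Unit w) := by
    ext i j
    have h1 : (M.transpose * M) i j = ⟪A (o i), A (o j)⟫ := by
      rw [Matrix.mul_apply, ← o.sum_inner_mul_inner]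
      refine Finset.sum_congr rfl fun k _ => ?_
      rw [Matrix.transpose_apply, hentry, hentry, real_inner_comm]
    rw [h1, hA]
    simp [Matrix.mul_apply, Matrix.one_apply, OrthonormalBasis.inner_eq_ite, w]
    field_simp
    simp only [mul_ite, mul_one, mul_zero]
  have hww : w ⬝ᵥ w = 1 := by
    have := o.sum_inner_mul_inner e e
    rw [real_inner_self_eq_norm_sq, he, one_pow] at this
    rw [← this]
    exact Finset.sum_congr rfl fun i _ => by
      change ⟪e, o i⟫ * ⟪e, o i⟫ = _
      rw [real_inner_comm (o i) e]
  have hdet : M.det ^ 2 = (s ^ (d - 1)) ^ 2 := by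
    have h := congrArg Matrix.det hMM
    rw [Matrix.det_mul, Matrix.det_transpose, Matrix.det_smul,
      Matrix.det_one_add_replicateCol_mul_replicateRow, dotProduct_smul, hww, Fintype.card_fin] at h
    rw [sq, h]
    obtain ⟨d', hd'⟩ := Nat.exists_eq_succ_of_ne_zero hdpos.ne'
    rw [hd', Nat.succ_sub_one, smul_eq_mul, Nat.succ_eq_add_one]
    field_simp
    ring
  rw [← LinearMap.det_toMatrix o.toBasis, ← abs_of_pos (pow_pos hs (d - 1))]
  exact (sq_eq_sq_iff_abs_eq_abs _ _).1 hdet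

variable [MeasurableSpace E] [BorelSpace E]

/-- Change of variables on the unit sphere, for the cone map `H` over a map `φ` of the sphere. -/
theorem toSphere_image (μ : Measure E) [μ.IsAddHaarMeasure]
    {φ : Metric.sphere (0 : E) 1 → Metric.sphere (0 : E) 1}
    (hφ : MeasurableEmbedding φ) {H : E → E} {H' : E → E →L[ℝ] E}
    {J : Metric.sphere (0 : E) 1 → ℝ}
    (hH : ∀ x : Metric.sphere (0 : E) 1, ∀ r : ℝ, 0 < r → H (r • x.1) = r • (φ x).1)
    (hH' : ∀ x, x ≠ 0 → HasFDerivAt H (H' x) x) (hJm : Measurable J)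
    (hJ : ∀ x : Metric.sphere (0 : E) 1, ∀ r : ℝ, 0 < r → |(H' (r • x.1)).det| = J x)
    {A : Set (Metric.sphere (0 : E) 1)} (hA : MeasurableSet A) :
    μ.toSphere (φ '' A) = ∫⁻ x in A, ENNReal.ofReal (J x) ∂μ.toSphere := by
  rcases subsingleton_or_nontrivial E with hE | hE
  · have : A = ∅ := by
      ext x
      have hx := x.2
      rw [Subsingleton.elim x.1 0] at hx
      simp at hx
    simp [this]
  set C : Set E := Set.Ioo (0 : ℝ) 1 • ((↑) '' A) with hC
  have hCpre : C = (↑) ''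
      (homeomorphUnitSphereProd E ⁻¹' (A ×ˢ Set.Iio ⟨1, Set.mem_Ioi.2 one_pos⟩)) := by
    rw [hC, ← Set.image2_smul, Set.image2_image_right, ← Homeomorph.image_symm, Set.image_image,
      show Set.Ioo (0 : ℝ) 1 = (↑) '' (Set.Iio (⟨1, Set.mem_Ioi.2 one_pos⟩ : Set.Ioi (0 : ℝ))) from
        (Set.image_subtype_val_Ioi_Iio (⟨1, Set.mem_Ioi.2 one_pos⟩ : Set.Ioi (0 : ℝ))).symm,
      Set.image2_image_left, Set.image2_swap,
      ← Set.image_prod]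
    rfl
  have hpre : MeasurableSet
      (homeomorphUnitSphereProd E ⁻¹' (A ×ˢ Set.Iio ⟨1, Set.mem_Ioi.2 one_pos⟩)) :=
    (homeomorphUnitSphereProd E).measurable (hA.prod measurableSet_Iio)
  have hcompl : MeasurableSet ({0}ᶜ : Set E) := (measurableSet_singleton _).compl
  have hCm : MeasurableSet C := by
    rw [hCpre]; exact (MeasurableEmbedding.subtype_coe hcompl).measurableSet_image.2 hpre
  have hmem : ∀ y ∈ C, ∃ r : ℝ, 0 < r ∧ r < 1 ∧
      ∃ x : Metric.sphere (0 : E) 1, x ∈ A ∧ y = r • x.1 := by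
    rintro y ⟨r, hr, _, ⟨x, hx, rfl⟩, rfl⟩
    exact ⟨r, hr.1, hr.2, x, hx, rfl⟩
  have hne : ∀ y ∈ C, y ≠ 0 := fun y hy => by
    rw [hCpre] at hy; obtain ⟨z, _, rfl⟩ := hy; exact z.2
  have himg : Set.Ioo (0 : ℝ) 1 • ((↑) '' (φ '' A) : Set E) = H '' C := by
    ext y
    constructor
    · rintro ⟨r, hr, _, ⟨_, ⟨x, hx, rfl⟩, rfl⟩, rfl⟩
      exact ⟨r • x.1, ⟨r, hr, x.1, ⟨x, hx, rfl⟩, rfl⟩, hH x r hr.1⟩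
    · rintro ⟨_, ⟨r, hr, _, ⟨x, hx, rfl⟩, rfl⟩, rfl⟩
      exact ⟨r, hr, _, ⟨_, ⟨x, hx, rfl⟩, rfl⟩, (hH x r hr.1).symm⟩
  have hinj : Set.InjOn H C := by
    intro y hy z hz hyz
    obtain ⟨r, hr, -, x, -, rfl⟩ := hmem y hy
    obtain ⟨t, ht, -, w, -, rfl⟩ := hmem z hz
    rw [hH x r hr, hH w t ht] at hyz
    have hrt : r = t := by
      have := congrArg norm hyz
      simpa [norm_smul, abs_of_pos hr, abs_of_pos ht] using this
    subst hrt
    have := hφ.injective (Subtype.ext (smul_right_injective E hr.ne' hyz))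
    rw [this]
  set g : E → ℝ≥0∞ := fun y => ENNReal.ofReal |(H' y).det| with hg
  have hgpolar : ∀ z : ({0}ᶜ : Set E),
      g z.1 = ENNReal.ofReal (J (homeomorphUnitSphereProd E z).1) := by
    intro z
    have hz : z.1 = (homeomorphUnitSphereProd E z).2.1 • (homeomorphUnitSphereProd E z).1.1 := by
      have h0 : ‖z.1‖ ≠ 0 := norm_ne_zero_iff.2 z.2
      simp [smul_smul, h0]
    rw [hg]
    simp only
    rw [hz, hJ _ _ (homeomorphUnitSphereProd E z).2.2]
  have hpos : 0 < Module.finrank ℝ E := Module.finrank_pos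
  rw [μ.toSphere_apply' (hφ.measurableSet_image.2 hA), himg,
    ← lintegral_abs_det_fderiv_eq_addHaar_image μ hCm
      (fun y hy => (hH' y (hne y hy)).hasFDerivWithinAt) hinj]
  change _ * ∫⁻ y in C, g y ∂μ = _
  rw [hCpre, ← setLIntegral_subtype hcompl]
  simp only [hgpolar]
  rw [μ.measurePreserving_homeomorphUnitSphereProd.setLIntegral_comp_preimage_emb
    (Homeomorph.measurableEmbedding _) (fun p => ENNReal.ofReal (J p.1)), ← Measure.prod_restrict]
  have hprod := lintegral_prod_mul (μ := μ.toSphere.restrict A)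
    (ν := (Measure.volumeIoiPow (Module.finrank ℝ E - 1)).restrict
      (Set.Iio ⟨1, Set.mem_Ioi.2 one_pos⟩))
    (f := fun x => ENNReal.ofReal (J x)) (g := fun _ => 1) (by fun_prop) (by fun_prop)
  simp only [mul_one] at hprod
  rw [hprod, lintegral_one, Measure.restrict_apply_univ, Measure.volumeIoiPow_apply_Iio, mul_left_comm,
    ← ENNReal.ofReal_natCast, ← ENNReal.ofReal_mul (by positivity), Nat.cast_pred hpos]
  have : (Module.finrank ℝ E : ℝ) ≠ 0 := by positivity
  simp [this]

end Sphere

section ConeMap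

open scoped RealInnerProductSpace

variable {E : Type*} [NormedAddCommGroup E] [InnerProductSpace ℝ E]

/-- The map between two spacelike hyperplanes that comes from identifying the rays of the light
cone, in orthonormal coordinates. -/
noncomputable def coneMap (B : E →L[ℝ] E) (a b : E) (c : ℝ) (x : E) : E :=
  (‖x‖ / (c * ‖x‖ - ⟪a, x⟫)) • (B x + ‖x‖ • b)

theorem exists_hasFDerivAt_coneMap {B : E →L[ℝ] E} {a b : E} {c : ℝ}
    (hB : ∀ v w, ⟪B v, B w⟫ = ⟪v, w⟫ + ⟪a, v⟫ * ⟪a, w⟫)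
    (hBb : ∀ v, ⟪B v, b⟫ = -c * ⟪a, v⟫) (hb : ⟪b, b⟫ = c ^ 2 - 1)
    {x : E} (hx : x ≠ 0) (hR : c * ‖x‖ - ⟪a, x⟫ ≠ 0) :
    ∃ H' : E →L[ℝ] E, HasFDerivAt (coneMap B a b c) H' x ∧
      ∀ v w, ⟪H' v, H' w⟫ = (‖x‖ / (c * ‖x‖ - ⟪a, x⟫)) ^ 2 * ⟪v, w⟫ +
        (1 - (‖x‖ / (c * ‖x‖ - ⟪a, x⟫)) ^ 2) * (⟪‖x‖⁻¹ • x, v⟫ * ⟪‖x‖⁻¹ • x, w⟫) := by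
  have hr0 : ‖x‖ ≠ 0 := norm_ne_zero_iff.2 hx
  have hn := hasFDerivAt_norm_of_ne_zero hx
  have hRd := (hn.const_mul c).sub ((innerSL ℝ a).hasFDerivAt (x := x))
  have hφ := hn.mul ((hasDerivAt_inv hR).comp_hasFDerivAt x hRd)
  have hy := B.hasFDerivAt.add (hn.smul_const b)
  refine ⟨_, hφ.smul hy, ?_⟩
  have hbn : ‖b‖ ^ 2 = c ^ 2 - 1 := by rw [← hb, real_inner_self_eq_norm_sq]
  have hBn : ‖B x‖ ^ 2 = ‖x‖ ^ 2 + ⟪a, x⟫ ^ 2 := by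
    rw [← real_inner_self_eq_norm_sq, hB, real_inner_self_eq_norm_sq, sq ⟪a, x⟫]
  have hbB : ∀ v, ⟪b, B v⟫ = -c * ⟪a, v⟫ := fun v => by rw [real_inner_comm, hBb]
  intro v w
  simp [inner_add_left, inner_add_right, inner_smul_left, inner_smul_right, hB, hBb, hbB, hbn, hBn]
  set r := ‖x‖
  set R := c * r - ⟪a, x⟫ with hRdef
  have hax : ⟪a, x⟫ = c * r - R := by rw [hRdef]; ring
  have hvx : ⟪v, x⟫ = ⟪x, v⟫ := real_inner_comm _ _
  rw [hax, hvx]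
  field_simp
  ring

variable [FiniteDimensional ℝ E] [MeasurableSpace E] [BorelSpace E]

theorem toSphere_image_coneMap (μ : Measure E) [μ.IsAddHaarMeasure] {B : E →L[ℝ] E} {a b : E}
    {c : ℝ} (hB : ∀ v w, ⟪B v, B w⟫ = ⟪v, w⟫ + ⟪a, v⟫ * ⟪a, w⟫)
    (hBb : ∀ v, ⟪B v, b⟫ = -c * ⟪a, v⟫) (hb : ⟪b, b⟫ = c ^ 2 - 1)
    (hR : ∀ x : Metric.sphere (0 : E) 1, 0 < c - ⟪a, x.1⟫)
    {φ : Metric.sphere (0 : E) 1 → Metric.sphere (0 : E) 1} (hφ : MeasurableEmbedding φ)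
    (hφB : ∀ x, (φ x).1 = (c - ⟪a, x.1⟫)⁻¹ • (B x.1 + b))
    {A : Set (Metric.sphere (0 : E) 1)} (hA : MeasurableSet A) :
    μ.toSphere (φ '' A) = ∫⁻ x in A,
      ENNReal.ofReal ((c - ⟪a, x.1⟫)⁻¹ ^ (Module.finrank ℝ E - 1)) ∂μ.toSphere := by
  have hscale : ∀ x : Metric.sphere (0 : E) 1, ∀ r : ℝ, 0 < r →
      ‖r • x.1‖ / (c * ‖r • x.1‖ - ⟪a, r • x.1⟫) = (c - ⟪a, x.1⟫)⁻¹ := by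
    intro x r hr
    have h1 : ‖r • x.1‖ = r := by simp [norm_smul, abs_of_pos hr]
    have h2 := (hR x).ne'
    have h3 : c * r - r * ⟪a, x.1⟫ = r * (c - ⟪a, x.1⟫) := by ring
    rw [h1, inner_smul_right, h3]
    field_simp
  have hpos : ∀ x : E, x ≠ 0 → 0 < c * ‖x‖ - ⟪a, x⟫ := by
    intro x hx
    have hx' := norm_pos_iff.2 hx
    have h := hR ⟨‖x‖⁻¹ • x, by simp [norm_smul, hx'.ne']⟩
    simp only [inner_smul_right] at h
    have := mul_pos hx' h
    field_simp at this
    linarith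
  choose! H' hH' hinner using fun (x : E) (hx : x ≠ 0) =>
    exists_hasFDerivAt_coneMap hB hBb hb hx (hpos x hx).ne'
  refine toSphere_image μ hφ (H := coneMap B a b c) (H' := H') ?_ hH' (by fun_prop) ?_ hA
  · intro x r hr
    rw [coneMap, hscale x r hr, hφB, map_smul, norm_smul, Real.norm_of_nonneg hr.le,
      norm_eq_of_mem_sphere x, mul_one, ← smul_add, smul_comm]
  · intro x r hr
    have hx0 : r • x.1 ≠ 0 := smul_ne_zero hr.ne' (ne_zero_of_mem_unit_sphere x)
    refine abs_det_of_inner_eq (A := (H' (r • x.1)).toLinearMap) (e := ‖r • x.1‖⁻¹ • r • x.1)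
      (norm_smul_inv_norm hx0) (inv_pos.2 (hR x)) ?_
    intro v w
    have := hinner _ hx0 v w
    rwa [hscale x r hr] at this

end ConeMap

section FrameCoordinates

open scoped RealInnerProductSpace

variable {n m : ℕ}

/-- The linear map with orthonormal frame `f`. -/
noncomputable def frameMap (f : Fin m → Mink n) : EuclideanSpace ℝ (Fin m) →L[ℝ] Mink n :=
  ∑ i, (EuclideanSpace.proj i : EuclideanSpace ℝ (Fin m) →L[ℝ] ℝ).smulRight (f i)

theorem frameMap_apply (f : Fin m → Mink n) (x : EuclideanSpace ℝ (Fin m)) :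
    frameMap f x = ∑ i, x i • f i := by
  simp [frameMap]

/-- Coordinates with respect to an orthonormal frame. -/
noncomputable def frameCoord (f : Fin m → Mink n) : Mink n →ₗ[ℝ] EuclideanSpace ℝ (Fin m) where
  toFun y := WithLp.toLp 2 fun i => form n (f i) y
  map_add' x y := by ext i; simp
  map_smul' c x := by ext i; simp

theorem frameCoord_apply (f : Fin m → Mink n) (y : Mink n) (i : Fin m) :
    frameCoord f y i = form n (f i) y := rfl

theorem inner_frameCoord (f : Fin m → Mink n) (y : Mink n) (x : EuclideanSpace ℝ (Fin m)) :
    ⟪frameCoord f y, x⟫ = form n (frameMap f x) y := by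
  simp [frameMap_apply, PiLp.inner_apply, frameCoord_apply]

variable {W : Submodule ℝ (Mink n)} {f : Fin m → Mink n}

theorem IsOrthonormalFrame.frameCoord_frameMap (hf : IsOrthonormalFrame W f)
    (x : EuclideanSpace ℝ (Fin m)) : frameCoord f (frameMap f x) = x := by
  ext i
  simp [frameCoord_apply, frameMap_apply, hf.1]

theorem IsOrthonormalFrame.frameMap_mem (hf : IsOrthonormalFrame W f)
    (x : EuclideanSpace ℝ (Fin m)) : frameMap f x ∈ W := by
  rw [frameMap_apply, ← hf.2]
  exact Submodule.sum_mem _ fun i _ =>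
    Submodule.smul_mem _ _ (Submodule.subset_span (Set.mem_range_self i))

theorem IsOrthonormalFrame.frameMap_frameCoord (hf : IsOrthonormalFrame W f) {y : Mink n}
    (hy : y ∈ W) : frameMap f (frameCoord f y) = y := by
  rw [← hf.2, Submodule.mem_span_range_iff_exists_fun] at hy
  obtain ⟨c, rfl⟩ := hy
  have : ∑ i, c i • f i = frameMap f (WithLp.toLp 2 c) := by simp [frameMap_apply]
  rw [this, hf.frameCoord_frameMap]

theorem IsOrthonormalFrame.form_frameMap (hf : IsOrthonormalFrame W f)
    (x y : EuclideanSpace ℝ (Fin m)) : form n (frameMap f x) (frameMap f y) = ⟪x, y⟫ := by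
  rw [← inner_frameCoord, hf.frameCoord_frameMap, real_inner_comm]

/-- The unit sphere of a subspace of Lorentz-Minkowski space. -/
def unitSphere (W : Submodule ℝ (Mink n)) : Set (Mink n) := {ξ | ξ ∈ W ∧ form n ξ ξ = 1}

/-- The parametrization of the unit sphere by an orthonormal frame. -/
noncomputable def sphereParam (f : Fin m → Mink n)
    (x : Metric.sphere (0 : EuclideanSpace ℝ (Fin m)) 1) : Mink n := frameMap f x.1

theorem continuous_sphereParam (f : Fin m → Mink n) : Continuous (sphereParam f) :=
  (frameMap f).continuous.comp continuous_subtype_val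

theorem IsOrthonormalFrame.frameMap_injective (hf : IsOrthonormalFrame W f) :
    Function.Injective (frameMap f) :=
  Function.LeftInverse.injective hf.frameCoord_frameMap

theorem IsOrthonormalFrame.measurableEmbedding_sphereParam (hf : IsOrthonormalFrame W f) :
    MeasurableEmbedding (sphereParam f) :=
  (continuous_sphereParam f).measurableEmbedding
    (hf.frameMap_injective.comp Subtype.val_injective)

theorem IsOrthonormalFrame.range_sphereParam (hf : IsOrthonormalFrame W f) :
    Set.range (sphereParam f) = unitSphere W := by
  ext ξ
  constructor
  · rintro ⟨x, rfl⟩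
    refine ⟨hf.frameMap_mem _, ?_⟩
    rw [sphereParam, hf.form_frameMap, real_inner_self_eq_norm_sq, norm_eq_of_mem_sphere, one_pow]
  · rintro ⟨h, h1⟩
    refine ⟨⟨frameCoord f ξ, ?_⟩, hf.frameMap_frameCoord h⟩
    rw [mem_sphere_zero_iff_norm, ← sq_eq_sq₀ (norm_nonneg _) zero_le_one,
      ← real_inner_self_eq_norm_sq, ← hf.form_frameMap, hf.frameMap_frameCoord h, h1, one_pow]

theorem exists_sphereMeasure_eq (h : ∃ f : Fin m → Mink n, IsOrthonormalFrame W f) :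
    ∃ f : Fin m → Mink n, IsOrthonormalFrame W f ∧ sphereMeasure m W =
      (volume : Measure (EuclideanSpace ℝ (Fin m))).toSphere.map (sphereParam f) := by
  refine ⟨h.choose, h.choose_spec, ?_⟩
  rw [sphereMeasure, dif_pos h]
  congr 1
  ext x : 1
  rw [sphereParam, frameMap_apply]

end FrameCoordinates

section Transition

open scoped RealInnerProductSpace

variable {n m : ℕ} {N : Submodule ℝ (Mink n)} {ν ν' : Mink n}

/-- The transition map between the unit spheres of `N ∩ ν^⊥` and `N ∩ ν'^⊥` given by the
rays of the light cone. -/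
noncomputable def transition (ν ν' ξ : Mink n) : Mink n :=
  (-form n (ν + ξ) ν')⁻¹ • (ν + ξ) - ν'

/-- The subspace of `N` orthogonal to `ν`. -/
noncomputable def spacelikePart (N : Submodule ℝ (Mink n)) (ν : Mink n) : Submodule ℝ (Mink n) :=
  N ⊓ (form n).orthogonal (Submodule.span ℝ {ν})

theorem mem_spacelikePart {ξ : Mink n} : ξ ∈ spacelikePart N ν ↔ ξ ∈ N ∧ form n ν ξ = 0 := by
  rw [spacelikePart, Submodule.mem_inf, mem_orthogonal_span_singleton]

/-- Future directed unit timelike vectors. -/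
structure IsFutureUnit (ν : Mink n) : Prop where
  unit : form n ν ν = -1
  future : 0 < ν 0

theorem IsFutureUnit.form_add_self (hν : IsFutureUnit ν) {ξ : Mink n}
    (hξ : ξ ∈ unitSphere (spacelikePart N ν)) : form n (ν + ξ) (ν + ξ) = 0 := by
  have h := (mem_spacelikePart.1 hξ.1).2
  have h1 := hξ.2
  simp [hν.unit, h, form_comm ξ ν, h1]

theorem IsFutureUnit.time_pos (hν : IsFutureUnit ν) {ξ : Mink n}
    (hξ : ξ ∈ unitSphere (spacelikePart N ν)) : 0 < (ν + ξ) 0 :=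
  time_add_pos hν.unit hν.future (mem_spacelikePart.1 hξ.1).2 hξ.2

theorem IsFutureUnit.neg_form_pos (hν : IsFutureUnit ν) (hν' : IsFutureUnit ν') {ξ : Mink n}
    (hξ : ξ ∈ unitSphere (spacelikePart N ν)) : 0 < -form n (ν + ξ) ν' :=
  neg_pos.2 (form_neg_of_future (hν.form_add_self hξ).le (hν.time_pos hξ)
    (by rw [hν'.unit]; norm_num) hν'.future)

theorem add_transition (ν ν' ξ : Mink n) :
    ν' + transition ν ν' ξ = (-form n (ν + ξ) ν')⁻¹ • (ν + ξ) := by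
  rw [transition]; abel

theorem transition_mem (hν : IsFutureUnit ν) (hν' : IsFutureUnit ν') (hN : ν ∈ N) (hN' : ν' ∈ N)
    {ξ : Mink n} (hξ : ξ ∈ unitSphere (spacelikePart N ν)) :
    transition ν ν' ξ ∈ unitSphere (spacelikePart N ν') := by
  have hρ := hν.neg_form_pos hν' hξ
  have hnull := hν.form_add_self hξ
  have hmem : ν + ξ ∈ N := N.add_mem hN (mem_spacelikePart.1 hξ.1).1
  rw [transition]
  set η := ν + ξ
  have hne : form n η ν' ≠ 0 := by linarith
  refine ⟨mem_spacelikePart.2 ⟨N.sub_mem (N.smul_mem _ hmem) hN', ?_⟩, ?_⟩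
  · simp [hν'.unit, form_comm ν' η]
    field_simp
    ring
  · simp [hν'.unit, form_comm ν' η, hnull]
    field_simp
    ring

theorem transition_transition (hν : IsFutureUnit ν) (hν' : IsFutureUnit ν') {ξ : Mink n}
    (hξ : ξ ∈ unitSphere (spacelikePart N ν)) :
    transition ν' ν (transition ν ν' ξ) = ξ := by
  have hρ := hν.neg_form_pos hν' hξ
  have h1 : form n (ν + ξ) ν = -1 := by
    simp [hν.unit, form_comm ξ ν, (mem_spacelikePart.1 hξ.1).2]
  rw [transition, add_transition, map_smul, LinearMap.smul_apply, h1, smul_smul]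
  have : -((-form n (ν + ξ) ν')⁻¹ • (-1 : ℝ)) = (-form n (ν + ξ) ν')⁻¹ := by simp
  rw [this, inv_inv, mul_inv_cancel₀ hρ.ne', one_smul, add_sub_cancel_left]

theorem bijOn_transition (hν : IsFutureUnit ν) (hν' : IsFutureUnit ν') (hN : ν ∈ N)
    (hN' : ν' ∈ N) : Set.BijOn (transition ν ν') (unitSphere (spacelikePart N ν))
      (unitSphere (spacelikePart N ν')) :=
  Set.InvOn.bijOn ⟨fun _ h => transition_transition hν hν' h,
    fun _ h => transition_transition hν' hν h⟩
    (fun _ h => transition_mem hν hν' hN hN' h) (fun _ h => transition_mem hν' hν hN' hN h)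

theorem normalize_smul {c : ℝ} (hc : c ≠ 0) (x : Mink n) : normalize (c • x) = normalize x := by
  rw [normalize, normalize, Pi.smul_apply, smul_eq_mul, smul_smul, mul_inv_rev,
    inv_mul_cancel_right₀ hc]

theorem normalize_add_transition (hν : IsFutureUnit ν) (hν' : IsFutureUnit ν') {ξ : Mink n}
    (hξ : ξ ∈ unitSphere (spacelikePart N ν)) :
    normalize (ν' + transition ν ν' ξ) = normalize (ν + ξ) := by
  rw [add_transition, normalize_smul (inv_ne_zero (hν.neg_form_pos hν' hξ).ne')]

theorem inv_time_add_transition (ν ν' ξ : Mink n) :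
    ((ν' + transition ν ν' ξ) 0)⁻¹ = -form n (ν + ξ) ν' * ((ν + ξ) 0)⁻¹ := by
  rw [add_transition, Pi.smul_apply, smul_eq_mul, mul_inv_rev, inv_inv, mul_comm]

theorem setIntegral_transition (hν : IsFutureUnit ν) (hν' : IsFutureUnit ν') (hN : ν ∈ N)
    (hN' : ν' ∈ N) {f f' : Fin m → Mink n} (hf : IsOrthonormalFrame (spacelikePart N ν) f)
    (hf' : IsOrthonormalFrame (spacelikePart N ν') f') {g g' : Mink n → ℝ}
    (hg : ∀ ξ ∈ unitSphere (spacelikePart N ν),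
      g ξ = (-form n (ν + ξ) ν')⁻¹ ^ (m - 1) * g' (transition ν ν' ξ))
    {A : Set (Mink n)} (hA : A ⊆ unitSphere (spacelikePart N ν)) (hAm : MeasurableSet A) :
    ∫ ξ in A, g ξ ∂(volume : Measure (EuclideanSpace ℝ (Fin m))).toSphere.map (sphereParam f) =
      ∫ ξ in transition ν ν' '' A, g' ξ
        ∂(volume : Measure (EuclideanSpace ℝ (Fin m))).toSphere.map (sphereParam f') := by
  have hι := hf.measurableEmbedding_sphereParam
  have hι' := hf'.measurableEmbedding_sphereParam
  have hmem : ∀ x, sphereParam f x ∈ unitSphere (spacelikePart N ν) := fun x => by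
    rw [← hf.range_sphereParam]; exact Set.mem_range_self x
  set F := frameMap f
  set P := frameCoord f'
  have hPν : P ν' = 0 := by
    ext i
    have : f' i ∈ spacelikePart N ν' := by
      rw [← hf'.2]; exact Submodule.subset_span (Set.mem_range_self i)
    simp [P, frameCoord_apply, form_comm _ ν', (mem_spacelikePart.1 this).2]
  -- decomposition of the vectors of `N` along `ν'`
  have hform : ∀ y ∈ N, ∀ z ∈ N, ⟪P y, P z⟫ = form n y z + form n y ν' * form n z ν' := by
    intro y hy z hz
    have hW : ∀ y ∈ N, y + form n y ν' • ν' ∈ spacelikePart N ν' := fun y hy =>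
      mem_spacelikePart.2 ⟨N.add_mem hy (N.smul_mem _ hN'), by simp [hν'.unit, form_comm ν' y]⟩
    have hP : ∀ y, P (y + form n y ν' • ν') = P y := fun y => by simp [hPν]
    rw [← hP y, ← hP z, ← hf'.form_frameMap, hf'.frameMap_frameCoord (hW y hy),
      hf'.frameMap_frameCoord (hW z hz)]
    simp [hν'.unit, form_comm ν' z]
    ring
  have hFN : ∀ x, F x ∈ N := fun x => (mem_spacelikePart.1 (hf.frameMap_mem x)).1
  have hFν : ∀ x, form n (F x) ν = 0 := fun x => by
    rw [form_comm]; exact (mem_spacelikePart.1 (hf.frameMap_mem x)).2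
  set a := frameCoord f ν'
  set c := -form n ν ν'
  have ha : ∀ x, ⟪a, x⟫ = form n (F x) ν' := inner_frameCoord f ν'
  have hρ : ∀ x : Metric.sphere (0 : EuclideanSpace ℝ (Fin m)) 1,
      -form n (ν + sphereParam f x) ν' = c - ⟪a, x.1⟫ := fun x => by
    rw [ha, map_add, LinearMap.add_apply, neg_add]; rfl
  have hR : ∀ x : Metric.sphere (0 : EuclideanSpace ℝ (Fin m)) 1, 0 < c - ⟪a, x.1⟫ := fun x => by
    rw [← hρ]; exact hν.neg_form_pos hν' (hmem x)
  set B : EuclideanSpace ℝ (Fin m) →L[ℝ] EuclideanSpace ℝ (Fin m) :=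
    LinearMap.toContinuousLinearMap (P ∘ₗ F.toLinearMap)
  set b := P ν
  have hBF : ∀ x, B x = P (F x) := fun x => rfl
  have hlift : ∀ x, ∃ y, sphereParam f' y = transition ν ν' (sphereParam f x) := fun x => by
    have := transition_mem hν hν' hN hN' (hmem x)
    rwa [← hf'.range_sphereParam] at this
  choose φ hφ using hlift
  have hφB : ∀ x, (φ x).1 = (c - ⟪a, x.1⟫)⁻¹ • (B x.1 + b) := by
    intro x
    rw [← hf'.frameCoord_frameMap (φ x).1]
    change P (sphereParam f' (φ x)) = _
    rw [hφ, transition, hρ, map_sub, hPν, sub_zero, map_smul, map_add, add_comm]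
    rfl
  have hφcont : Continuous φ := by
    rw [continuous_induced_rng]
    simp only [Function.comp_def, hφB]
    have h1 : Continuous fun x : Metric.sphere (0 : EuclideanSpace ℝ (Fin m)) 1 => c - ⟪a, x.1⟫ := by
      fun_prop
    exact (h1.inv₀ fun x => (hR x).ne').smul (by fun_prop)
  have hφinj : Function.Injective φ := by
    intro x y h
    apply hι.injective
    apply (bijOn_transition hν hν' hN hN').injOn (hmem x) (hmem y)
    rw [← hφ, ← hφ, h]
  have hφm : MeasurableEmbedding φ := hφcont.measurableEmbedding hφinj
  set σ := (volume : Measure (EuclideanSpace ℝ (Fin m))).toSphere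
  set J : Metric.sphere (0 : EuclideanSpace ℝ (Fin m)) 1 → ℝ := fun x => (c - ⟪a, x.1⟫)⁻¹ ^ (m - 1)
  have hpull : σ.comap φ = σ.withDensity fun x => ENNReal.ofReal (J x) := by
    ext s hs
    rw [hφm.comap_apply, withDensity_apply _ hs]
    have := toSphere_image_coneMap (volume : Measure (EuclideanSpace ℝ (Fin m)))
      (B := B) (a := a) (b := b) (c := c) ?_ ?_ ?_ hR hφm hφB hs
    · rwa [finrank_euclideanSpace_fin] at this
    · intro v w
      rw [hBF, hBF, hform _ (hFN v) _ (hFN w), hf.form_frameMap, ha, ha]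
    · intro v
      rw [hBF, hform _ (hFN v) _ hN, hFν, ha]
      ring
    · rw [hform _ hN _ hN, hν.unit]
      ring
  have himg : sphereParam f' ⁻¹' (transition ν ν' '' A) = φ '' (sphereParam f ⁻¹' A) := by
    ext y
    constructor
    · rintro ⟨ξ, hξ, hy⟩
      obtain ⟨x, rfl⟩ : ξ ∈ Set.range (sphereParam f) := by
        rw [hf.range_sphereParam]; exact hA hξ
      exact ⟨x, hξ, hι'.injective ((hφ x).trans hy)⟩
    · rintro ⟨x, hx, rfl⟩
      exact ⟨sphereParam f x, hx, (hφ x).symm⟩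
  have hA' : MeasurableSet (sphereParam f ⁻¹' A) := hι.measurable hAm
  set A' := sphereParam f ⁻¹' A
  have hJm : Measurable J := by fun_prop
  rw [hι.setIntegral_map, hι'.setIntegral_map, himg]
  calc ∫ x in A', g (sphereParam f x) ∂σ
      = ∫ x in A', J x • g' (sphereParam f' (φ x)) ∂σ := by
        refine setIntegral_congr_fun hA' fun x _ => ?_
        simp only [hg _ (hmem x), hρ, hφ, J, smul_eq_mul]
    _ = ∫ x in A', g' (sphereParam f' (φ x)) ∂σ.comap φ := by
        rw [hpull, setIntegral_withDensity_eq_setIntegral_toReal_smul (by fun_prop)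
          (Filter.Eventually.of_forall fun _ => ENNReal.ofReal_lt_top) _ hA']
        refine setIntegral_congr_fun hA' fun x _ => ?_
        simp only [ENNReal.toReal_ofReal (pow_nonneg (inv_nonneg.2 (hR x).le) _), J]
    _ = ∫ y in φ '' A', g' (sphereParam f' y) ∂(σ.comap φ).map φ := by
        rw [hφm.setIntegral_map, Set.preimage_image_eq _ hφinj]
    _ = ∫ y in φ '' A', g' (sphereParam f' y) ∂σ := by
        rw [hφm.map_comap, Measure.restrict_restrict_of_subset (Set.image_subset_range _ _)]

end Transition

section LinearAlgebra

variable {n : ℕ}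

theorem form_orthProj {W : Submodule ℝ (Mink n)} (h : IsCompl W ((form n).orthogonal W))
    {w : Mink n} (hw : w ∈ W) (y : Mink n) : form n w (orthProj W y) = form n w y := by
  rw [orthProj, dif_pos h]
  have : y - W.projectionOnto _ h y ∈ (form n).orthogonal W := by
    rw [← Submodule.projectionOnto_apply_eq_zero_iff h, map_sub,
      Submodule.projectionOnto_apply_left, sub_self]
  have := this w hw
  rw [map_sub] at this
  linarith

theorem orthProj_apply_of_mem {W : Submodule ℝ (Mink n)}
    (h : IsCompl W ((form n).orthogonal W)) {w : Mink n} (hw : w ∈ W) :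
    (orthProj W w : Mink n) = w := by
  rw [orthProj, dif_pos h, Submodule.projectionOnto_apply_of_mem_left h hw]

theorem eq_zero_of_orthogonal {ν : Mink n} (hν : form n ν ν = -1) {y : Mink n}
    (hy : form n ν y = 0) (h : form n y y = 0) : y = 0 := by
  by_contra h0
  exact (form_pos_of_orthogonal hν hy h0).ne' h

theorem finrank_sup_span_singleton_of_orthogonal {W : Submodule ℝ (Mink n)} {x : Mink n}
    (hx : form n x x ≠ 0) (hW : ∀ w ∈ W, form n w x = 0) :
    Module.finrank ℝ ↥(W ⊔ Submodule.span ℝ {x}) = Module.finrank ℝ W + 1 :=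
  Submodule.finrank_sup_span_singleton fun h => hx (hW x h)

theorem orthogonal_sup_span_singleton (W : Submodule ℝ (Mink n)) (x : Mink n) :
    (form n).orthogonal (W ⊔ Submodule.span ℝ {x}) =
      (form n).orthogonal W ⊓ (form n).orthogonal (Submodule.span ℝ {x}) := by
  refine le_antisymm (le_inf (LinearMap.BilinForm.orthogonal_le le_sup_left)
    (LinearMap.BilinForm.orthogonal_le le_sup_right)) fun y hy z hz => ?_
  obtain ⟨a, ha, b, hb, rfl⟩ := Submodule.mem_sup.1 hz
  have h1 : form n a y = 0 := hy.1 a ha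
  have h2 : form n b y = 0 := hy.2 b hb
  rw [map_add, LinearMap.add_apply, h1, h2, add_zero]

/-- The determinant of an endomorphism of `T ⊕ F` that is block triangular with respect to this
decomposition and a multiple of the identity on `F`. -/
theorem abs_det_of_adapted {ν : Mink n} (hν : form n ν ν = -1) {s : ℕ} {x : Fin s → Mink n}
    (hx : LinearIndependent ℝ x) {F S : Submodule ℝ (Mink n)}
    (hS : Submodule.span ℝ (Set.range x) ⊔ F = S) (hSν : ∀ y ∈ S, form n ν y = 0)
    (hxF : ∀ i, ∀ y ∈ F, form n (x i) y = 0) (L : S →ₗ[ℝ] S) (c : ℝ)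
    (h : Matrix (Fin s) (Fin s) ℝ)
    (hL₁₁ : ∀ i, ∀ y : S, ∀ j, (y : Mink n) = x j → form n (x i) (L y) = h i j)
    (hL₁₂ : ∀ i, ∀ y : S, (y : Mink n) ∈ F → form n (x i) (L y) = 0)
    (hL₂₂ : ∀ z ∈ F, ∀ y : S, (y : Mink n) ∈ F → form n z (L y) = c * form n z y) :
    |LinearMap.det L| = |c| ^ Module.finrank ℝ F *
      |h.det / (Matrix.of fun i j => form n (x i) (x j)).det| := by
  have hFS : F ≤ S := hS ▸ le_sup_right
  obtain ⟨d, hd⟩ : ∃ d, Module.finrank ℝ F = d := ⟨_, rfl⟩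
  obtain ⟨f, hf⟩ := exists_orthonormalFrame hν (fun y hy => hSν y (hFS hy)) hd
  rw [hd]
  have hfF : ∀ i, f i ∈ F := fun i => by
    rw [← hf.2]; exact Submodule.subset_span (Set.mem_range_self i)
  have hfli : LinearIndependent ℝ f := by
    rw [linearIndependent_iff_card_eq_finrank_span, Set.finrank, hf.2, hd, Fintype.card_fin]
  have hxspan : ∀ z ∈ Submodule.span ℝ (Set.range x), ∀ y ∈ F, form n z y = 0 := by
    intro z hz y hy
    induction hz using Submodule.span_induction with
    | mem z hz => obtain ⟨i, rfl⟩ := hz; exact hxF i y hy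
    | zero => simp
    | add a b _ _ ha hb => simp [ha, hb]
    | smul r a _ ha => simp [ha]
  have hdisj : Disjoint (Submodule.span ℝ (Set.range x)) (Submodule.span ℝ (Set.range f)) := by
    rw [hf.2, Submodule.disjoint_def]
    intro y hy hy'
    exact eq_zero_of_orthogonal hν (hSν y (hFS hy')) (hxspan y hy y hy')
  have hli := hx.sum_type hfli hdisj
  have hspan : Submodule.span ℝ (Set.range (Sum.elim x f)) = S := by
    rw [Set.Sum.elim_range, Submodule.span_union, hf.2, hS]
  set b : Module.Basis (Fin s ⊕ Fin d) ℝ S :=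
    (Module.Basis.span hli).map (LinearEquiv.ofEq _ _ hspan) with hb
  have hbapply : ∀ i, (b i : Mink n) = Sum.elim x f i := fun i => by
    simp [hb, Module.Basis.span_apply]
  have hcompl := isCompl_orthogonal hν hSν
  set G := LinearMap.BilinForm.toMatrix b ((form n).restrict S)
  have hG0 : G.det ≠ 0 := (LinearMap.BilinForm.nondegenerate_iff_det_ne_zero b).1
    ((LinearMap.BilinForm.restrict_nondegenerate_iff_isCompl_orthogonal form_isRefl).2 hcompl)
  have hGdef : ∀ i j, G i j = form n (b i) (b j) := fun i j =>
    LinearMap.BilinForm.toMatrix_apply _ _ _ _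
  have hG : G = Matrix.fromBlocks (Matrix.of fun i j => form n (x i) (x j)) 0 0 1 := by
    ext (i | i) (j | j) <;> rw [hGdef, hbapply, hbapply]
    · rfl
    · exact hxF i _ (hfF j)
    · exact (form_comm _ _).trans (hxF j _ (hfF i))
    · exact (hf.1 i j).trans (Matrix.one_apply ..).symm
  set M := LinearMap.BilinForm.toMatrix b (((form n).restrict S).compRight L)
  have hMG : M = G * LinearMap.toMatrix b b L := LinearMap.BilinForm.toMatrix_compRight _ _ _
  have hMdef : ∀ i j, M i j = form n (b i) (L (b j)) := fun i j =>
    LinearMap.BilinForm.toMatrix_apply _ _ _ _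
  have hM : M = Matrix.fromBlocks h 0
      (Matrix.of fun i j => form n (f i) (L (b (Sum.inl j)))) (c • 1) := by
    have hbF : ∀ j, (b (Sum.inr j) : Mink n) ∈ F := fun j => by rw [hbapply]; exact hfF j
    ext (i | i) (j | j) <;> rw [hMdef, hbapply]
    · exact hL₁₁ i _ j (hbapply _)
    · exact hL₁₂ i _ (hbF j)
    · rfl
    · refine (hL₂₂ _ (hfF i) _ (hbF j)).trans ?_
      rw [hbapply, Sum.elim_inr, hf.1]
      simp [Matrix.one_apply]
  have hdet := congrArg Matrix.det hMG
  rw [Matrix.det_mul, LinearMap.det_toMatrix] at hdet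
  have hdM : M.det = h.det * c ^ d := by
    rw [hM, Matrix.det_fromBlocks_zero₁₂, Matrix.det_smul, Matrix.det_one, mul_one,
      Fintype.card_fin]
  have hdG : G.det = (Matrix.of fun i j => form n (x i) (x j)).det := by
    rw [hG, Matrix.det_fromBlocks_zero₁₂, Matrix.det_one, mul_one]
  rw [← hdG, ← abs_pow, ← abs_mul]
  congr 1
  rw [mul_div_assoc', eq_div_iff hG0, mul_comm, ← hdet, hdM, mul_comm]

end LinearAlgebra

section Calculus

variable {n : ℕ} {V : Type*} [NormedAddCommGroup V] [NormedSpace ℝ V]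

theorem hasFDerivAt_form {f g : V → Mink n} {f' g' : V →L[ℝ] Mink n} {x : V}
    (hf : HasFDerivAt f f' x) (hg : HasFDerivAt g g' x) :
    ∃ D : V →L[ℝ] ℝ, HasFDerivAt (fun y => form n (f y) (g y)) D x ∧
      ∀ v, D v = form n (f' v) (g x) + form n (f x) (g' v) :=
  ⟨_, (form n).toContinuousBilinearMap.hasFDerivAt_of_bilinear hf hg, fun v => by
    simp [add_comm]⟩

theorem hasFDerivAt_normalize {f : V → Mink n} {f' : V →L[ℝ] Mink n} {x : V}
    (hf : HasFDerivAt f f' x) (h0 : f x 0 ≠ 0) :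
    ∃ D : V →L[ℝ] Mink n, HasFDerivAt (fun y => normalize (f y)) D x ∧
      ∀ v, ∃ r : ℝ, D v = (f x 0)⁻¹ • f' v + r • f x := by
  have h1 := (hasFDerivAt_pi'.1 hf 0)
  exact ⟨_, ((hasDerivAt_inv h0).comp_hasFDerivAt x h1).smul hf, fun v => ⟨_, by
    simp only [add_apply, smul_apply, ContinuousLinearMap.smulRight_apply]; rfl⟩⟩

end Calculus

section Immersion

variable {s n : ℕ} {U : Set (Param s)} {X nT : Param s → Mink n} {u : Param s}

theorem tangentSpace_eq_range (X : Param s → Mink n) (u : Param s) :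
    tangentSpace X u = LinearMap.range (fderiv ℝ X u).toLinearMap := by
  have h := (EuclideanSpace.basisFun (Fin s) ℝ).toBasis.span_eq
  rw [LinearMap.range_eq_map, ← h, Submodule.map_span, ← Set.range_comp, tangentSpace]
  congr 2
  ext i : 1
  simp [partialDeriv]

theorem fderiv_apply_mem_tangentSpace (X : Param s → Mink n) (u w : Param s) :
    fderiv ℝ X u w ∈ tangentSpace X u := by
  rw [tangentSpace_eq_range]; exact ⟨w, rfl⟩

theorem IsSpacelikeEmbedding.finrank_tangentSpace (hX : IsSpacelikeEmbedding U X) (hu : u ∈ U) :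
    Module.finrank ℝ (tangentSpace X u) = s := by
  rw [tangentSpace_eq_range, LinearMap.finrank_range_of_inj (hX.immersive u hu),
    finrank_euclideanSpace_fin]

theorem IsSpacelikeEmbedding.linearIndependent (hX : IsSpacelikeEmbedding U X) (hu : u ∈ U) :
    LinearIndependent ℝ fun i => partialDeriv X i u := by
  rw [linearIndependent_iff_card_eq_finrank_span, Set.finrank]
  exact (Fintype.card_fin s).trans (hX.finrank_tangentSpace hu).symm

theorem IsSpacelikeEmbedding.differentiableAt_partialDeriv (hX : IsSpacelikeEmbedding U X)
    (hu : u ∈ U) (i : Fin s) : DifferentiableAt ℝ (partialDeriv X i) u := by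
  have h : ContDiffAt ℝ ∞ X u := hX.smooth.contDiffAt (hX.isOpen.mem_nhds hu)
  have h' : ContDiffAt ℝ 1 (fderiv ℝ X) u := h.fderiv_right (by norm_cast)
  exact (h'.differentiableAt one_ne_zero).clm_apply (differentiableAt_const _)

theorem IsFutureUnitTimelikeNormal.differentiableAt (hX : IsSpacelikeEmbedding U X)
    (hnT : IsFutureUnitTimelikeNormal U X nT) (hu : u ∈ U) : DifferentiableAt ℝ nT u :=
  (hnT.smooth.contDiffAt (hX.isOpen.mem_nhds hu)).differentiableAt (by simp)

theorem IsFutureUnitTimelikeNormal.isFutureUnit (hnT : IsFutureUnitTimelikeNormal U X nT)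
    (hu : u ∈ U) : IsFutureUnit (nT u) := ⟨hnT.unit u hu, hnT.future u hu⟩

theorem form_partialDeriv_of_mem_normalSpace {η : Mink n} (hη : η ∈ normalSpace X u) (i : Fin s) :
    form n (partialDeriv X i u) η = 0 :=
  hη _ (Submodule.subset_span (Set.mem_range_self i))

/-- Differentiating `⟨nT, X_{u_i}⟩ = 0`. -/
theorem IsFutureUnitTimelikeNormal.form_fderiv (hX : IsSpacelikeEmbedding U X)
    (hnT : IsFutureUnitTimelikeNormal U X nT) (hu : u ∈ U) (i : Fin s) (w : Param s) :
    form n (fderiv ℝ nT u w) (partialDeriv X i u) =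
      -form n (nT u) (fderiv ℝ (partialDeriv X i) u w) := by
  obtain ⟨D, hD, hDv⟩ := hasFDerivAt_form (hnT.differentiableAt hX hu).hasFDerivAt
    (hX.differentiableAt_partialDeriv hu i).hasFDerivAt
  have h0 : (fun v => form n (nT v) (partialDeriv X i v)) =ᶠ[nhds u] fun _ => 0 := by
    filter_upwards [hX.isOpen.mem_nhds hu] with v hv
    rw [form_comm]
    exact form_partialDeriv_of_mem_normalSpace (hnT.normal v hv) i
  have hD0 : D = 0 := hD.unique ((hasFDerivAt_const (0 : ℝ) u).congr_of_eventuallyEq h0)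
  have := hDv w
  rw [hD0, zero_apply] at this
  linarith

theorem fiber_eq (X nT : Param s → Mink n) (u : Param s) :
    fiber X nT u = unitSphere (spacelikePart (normalSpace X u) (nT u)) := rfl

end Immersion

section Curvature

variable {s n : ℕ} {U : Set (Param s)} {X nT : Param s → Mink n} {u : Param s} {ξ : Mink n}

/-- The matrix `⟨η, X_{u_i u_j}⟩` of the second fundamental form in direction `η`. -/
noncomputable def secondForm (X : Param s → Mink n) (u : Param s) (η : Mink n) :
    Matrix (Fin s) (Fin s) ℝ :=
  Matrix.of fun i j => form n η (fderiv ℝ (partialDeriv X i) u (EuclideanSpace.single j 1))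

/-- The matrix `⟨X_{u_i}, X_{u_j}⟩` of the first fundamental form. -/
noncomputable def firstForm (X : Param s → Mink n) (u : Param s) : Matrix (Fin s) (Fin s) ℝ :=
  Matrix.of fun i j => form n (partialDeriv X i u) (partialDeriv X j u)

/-- The absolute Lipschitz-Killing curvature in the normal direction `η`. -/
noncomputable def absCurvature (X : Param s → Mink n) (u : Param s) (η : Mink n) : ℝ :=
  |(secondForm X u η).det / (firstForm X u).det|

theorem form_of_mem_bundleTangent (hX : IsSpacelikeEmbedding U X)
    (hnT : IsFutureUnitTimelikeNormal U X nT) (hu : u ∈ U) {q : Param s × Mink n}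
    (hq : q ∈ bundleTangent X nT u ξ) :
    form n ξ q.2 = 0 ∧ form n (nT u) q.2 = -form n ξ (fderiv ℝ nT u q.1) ∧
      ∀ i, form n (partialDeriv X i u) q.2 =
        -form n ξ (fderiv ℝ (partialDeriv X i) u q.1) := by
  have h2 : HasFDerivAt (fun q : Param s × Mink n => q.2)
      (ContinuousLinearMap.snd ℝ (Param s) (Mink n)) (u, ξ) := hasFDerivAt_snd
  have hcomp : ∀ {g : Param s → Mink n}, DifferentiableAt ℝ g u →
      HasFDerivAt (fun q : Param s × Mink n => g q.1)
        ((fderiv ℝ g u).comp (ContinuousLinearMap.fst ℝ (Param s) (Mink n))) (u, ξ) := fun hg =>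
    HasFDerivAt.comp (g := _) (u, ξ) (by exact hg.hasFDerivAt) hasFDerivAt_fst
  obtain ⟨D₁, hD₁, hv₁⟩ := hasFDerivAt_form h2 h2
  obtain ⟨D₂, hD₂, hv₂⟩ := hasFDerivAt_form h2 (hcomp (hnT.differentiableAt hX hu))
  choose D₃ hD₃ hv₃ using fun i =>
    hasFDerivAt_form h2 (hcomp (hX.differentiableAt_partialDeriv hu i))
  have hD : HasFDerivAt (bundleEquations X nT) (D₁.prod (D₂.prod (ContinuousLinearMap.pi D₃)))
      (u, ξ) := hD₁.prodMk (hD₂.prodMk (hasFDerivAt_pi.2 hD₃))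
  have hq' : (D₁.prod (D₂.prod (ContinuousLinearMap.pi D₃))) q = 0 := by
    rw [← hD.fderiv]; exact hq
  have e₁ : D₁ q = 0 := congrArg Prod.fst hq'
  have e₂ : D₂ q = 0 := congrArg (fun p => p.2.1) hq'
  have e₃ : ∀ i, D₃ i q = 0 := fun i => congrFun (congrArg (fun p => p.2.2) hq') i
  rw [hv₁] at e₁
  rw [hv₂] at e₂
  simp only [hv₃] at e₃
  simp only [ContinuousLinearMap.coe_snd', ContinuousLinearMap.comp_apply,
    ContinuousLinearMap.coe_fst'] at e₁ e₂ e₃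
  refine ⟨?_, ?_, fun i => ?_⟩
  · rw [form_comm q.2 ξ] at e₁; linarith
  · rw [form_comm]; linarith
  · rw [form_comm]; linarith [e₃ i]

theorem fderiv_lightconeGauss (hX : IsSpacelikeEmbedding U X)
    (hnT : IsFutureUnitTimelikeNormal U X nT) (hu : u ∈ U) (h0 : (nT u + ξ) 0 ≠ 0)
    (q : Param s × Mink n) : ∃ r : ℝ, fderiv ℝ (lightconeGauss nT) (u, ξ) q =
      ((nT u + ξ) 0)⁻¹ • (fderiv ℝ nT u q.1 + q.2) + r • (nT u + ξ) := by
  have h1 : HasFDerivAt (fun q : Param s × Mink n => nT q.1)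
      ((fderiv ℝ nT u).comp (ContinuousLinearMap.fst ℝ (Param s) (Mink n))) (u, ξ) :=
    HasFDerivAt.comp (g := nT) (u, ξ) (hnT.differentiableAt hX hu).hasFDerivAt hasFDerivAt_fst
  have h2 : HasFDerivAt (fun q : Param s × Mink n => q.2)
      (ContinuousLinearMap.snd ℝ (Param s) (Mink n)) (u, ξ) := hasFDerivAt_snd
  obtain ⟨D, hD, hv⟩ := hasFDerivAt_normalize (h1.add h2) h0
  obtain ⟨r, hr⟩ := hv q
  exact ⟨r, (congrArg (fun A : Param s × Mink n →L[ℝ] Mink n => A q) hD.fderiv).trans hr⟩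

theorem form_splitTangent (hnT : IsFutureUnitTimelikeNormal U X nT) (hu : u ∈ U)
    (hξ : ξ ∈ fiber X nT u) {y : Mink n} (hy : y ∈ splitTangent X nT u ξ) :
    form n (nT u) y = 0 ∧ form n ξ y = 0 := by
  obtain ⟨t, ht, f, hf, rfl⟩ := Submodule.mem_sup.1 hy
  have h1 : form n t (nT u) = 0 := hnT.normal u hu t ht
  have h2 : form n t ξ = 0 := (mem_spacelikePart.1 hξ.1).1 t ht
  have h3 : form n (nT u) f = 0 := mem_orthogonal_span_singleton.1 hf.1.2
  have h4 : form n ξ f = 0 := mem_orthogonal_span_singleton.1 hf.2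
  rw [map_add, map_add, form_comm _ t, form_comm _ t, h1, h2, h3, h4]
  simp

theorem canonicalIdent_apply (hnT : IsFutureUnitTimelikeNormal U X nT) (hu : u ∈ U)
    (hξ : ξ ∈ fiber X nT u) (q : bundleTangent X nT u ξ) :
    (canonicalIdent X nT u ξ q : Mink n) =
      fderiv ℝ X u q.1.1 + orthProj (fiberTangent X nT u ξ) q.1.2 :=
  orthProj_apply_of_mem (isCompl_orthogonal (hnT.unit u hu)
    fun _ hy => (form_splitTangent hnT hu hξ hy).1)
    (Submodule.add_mem_sup (fderiv_apply_mem_tangentSpace X u q.1.1) (Subtype.mem _))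

theorem form_tangentSpace_fiberTangent {t f : Mink n} (ht : t ∈ tangentSpace X u)
    (hf : f ∈ fiberTangent X nT u ξ) : form n t f = 0 := hf.1.1 t ht

theorem disjoint_tangentSpace_fiberTangent (hnT : IsFutureUnitTimelikeNormal U X nT)
    (hu : u ∈ U) : Disjoint (tangentSpace X u) (fiberTangent X nT u ξ) := by
  rw [Submodule.disjoint_def]
  intro y hy hy'
  exact eq_zero_of_orthogonal (hnT.unit u hu) (mem_orthogonal_span_singleton.1 hy'.1.2)
    (form_tangentSpace_fiberTangent hy hy')

/-- The components of a vector of `T_pM ⊕ T_ξ S^{k-2}` are unique. -/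
theorem components_eq (hnT : IsFutureUnitTimelikeNormal U X nT) (hu : u ∈ U)
    {t t' f f' : Mink n} (ht : t ∈ tangentSpace X u) (ht' : t' ∈ tangentSpace X u)
    (hf : f ∈ fiberTangent X nT u ξ) (hf' : f' ∈ fiberTangent X nT u ξ)
    (h : t + f = t' + f') : t = t' ∧ f = f' := by
  have h1 : t - t' = f' - f := by rw [sub_eq_sub_iff_add_eq_add, h, add_comm]
  have h2 : t - t' = 0 := Submodule.disjoint_def.1 (disjoint_tangentSpace_fiberTangent hnT hu) _
    (Submodule.sub_mem _ ht ht') (h1 ▸ Submodule.sub_mem _ hf' hf)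
  exact ⟨sub_eq_zero.1 h2, (sub_eq_zero.1 (h1 ▸ h2)).symm⟩

theorem isCompl_fiberTangent (hnT : IsFutureUnitTimelikeNormal U X nT) (hu : u ∈ U) :
    IsCompl (fiberTangent X nT u ξ) ((form n).orthogonal (fiberTangent X nT u ξ)) :=
  isCompl_orthogonal (hnT.unit u hu) fun _ hy => mem_orthogonal_span_singleton.1 hy.1.2

theorem canonicalIdent_injective (hX : IsSpacelikeEmbedding U X)
    (hnT : IsFutureUnitTimelikeNormal U X nT) (hu : u ∈ U) (hξ : ξ ∈ fiber X nT u) :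
    Function.Injective (canonicalIdent X nT u ξ) := by
  rw [← LinearMap.ker_eq_bot, LinearMap.ker_eq_bot']
  intro q hq
  have h := canonicalIdent_apply hnT hu hξ q
  rw [hq, Submodule.coe_zero] at h
  obtain ⟨h1, h2⟩ := components_eq hnT hu (Submodule.zero_mem _)
    (fderiv_apply_mem_tangentSpace X u q.1.1) (Submodule.zero_mem _)
    (orthProj (fiberTangent X nT u ξ) q.1.2).2 ((add_zero (0 : Mink n)).trans h)
  have hw : q.1.1 = 0 := hX.immersive u hu (by rw [← h1, map_zero])
  obtain ⟨e1, e2, e3⟩ := form_of_mem_bundleTangent hX hnT hu q.2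
  simp only [hw, map_zero, neg_zero] at e2 e3
  have hF : q.1.2 ∈ fiberTangent X nT u ξ := by
    refine ⟨⟨fun t ht => ?_, mem_orthogonal_span_singleton.2 e2⟩,
      mem_orthogonal_span_singleton.2 e1⟩
    induction ht using Submodule.span_induction with
    | mem z hz => obtain ⟨i, rfl⟩ := hz; exact e3 i
    | zero => simp
    | add a b _ _ ha hb => rw [map_add, LinearMap.add_apply, ha, hb, add_zero]
    | smul r a _ ha => rw [map_smul, LinearMap.smul_apply, ha, smul_zero]
  rw [orthProj_apply_of_mem (isCompl_fiberTangent hnT hu) hF] at h2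
  exact Subtype.ext (Prod.ext hw h2.symm)

theorem finrank_splitTangent_le (hnT : IsFutureUnitTimelikeNormal U X nT) (hu : u ∈ U)
    (hξ : ξ ∈ fiber X nT u) : Module.finrank ℝ (splitTangent X nT u ξ) + 2 ≤ n + 1 := by
  have hν := hnT.unit u hu
  have h1 := finrank_sup_span_singleton_of_orthogonal (W := splitTangent X nT u ξ) (x := ξ)
    (by rw [hξ.2]; norm_num)
    fun w hw => by rw [form_comm]; exact (form_splitTangent hnT hu hξ hw).2
  have h2 := finrank_sup_span_singleton_of_orthogonal
    (W := splitTangent X nT u ξ ⊔ Submodule.span ℝ {ξ}) (x := nT u)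
    (by rw [hν]; norm_num) fun w hw => by
      obtain ⟨a, ha, b, hb, rfl⟩ := Submodule.mem_sup.1 hw
      obtain ⟨c, rfl⟩ := Submodule.mem_span_singleton.1 hb
      rw [form_comm, map_add, map_smul, (form_splitTangent hnT hu hξ ha).1,
        (mem_spacelikePart.1 hξ.1).2, smul_zero, add_zero]
  have h3 := Submodule.finrank_le
    (splitTangent X nT u ξ ⊔ Submodule.span ℝ {ξ} ⊔ Submodule.span ℝ {nT u})
  rw [Module.finrank_fin_fun] at h3
  omega

theorem canonicalIdent_bijective (hX : IsSpacelikeEmbedding U X)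
    (hnT : IsFutureUnitTimelikeNormal U X nT) (hu : u ∈ U) (hξ : ξ ∈ fiber X nT u) :
    Function.Bijective (canonicalIdent X nT u ξ) := by
  have hinj := canonicalIdent_injective hX hnT hu hξ
  have hle := LinearMap.finrank_le_finrank_of_injective hinj
  have hS := finrank_splitTangent_le hnT hu hξ
  have hker := LinearMap.finrank_range_add_finrank_ker
    (fderiv ℝ (bundleEquations X nT) (u, ξ)).toLinearMap
  have hrange := Submodule.finrank_le
    (LinearMap.range (fderiv ℝ (bundleEquations X nT) (u, ξ)).toLinearMap)
  change _ + Module.finrank ℝ (bundleTangent X nT u ξ) = _ at hker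
  simp only [Module.finrank_prod, finrank_euclideanSpace_fin, Module.finrank_fin_fun,
    Module.finrank_self] at hker hrange
  exact ⟨hinj, (LinearMap.injective_iff_surjective_of_finrank_eq_finrank (by omega)).1 hinj⟩

/-- The normalized lightcone Lipschitz-Killing curvature depends on `nT` only through the null
direction and a power of its normalizing factor. -/
theorem abs_lipschitzKilling (hX : IsSpacelikeEmbedding U X)
    (hnT : IsFutureUnitTimelikeNormal U X nT) (hu : u ∈ U) (hξ : ξ ∈ fiber X nT u) :
    |lipschitzKilling X nT u ξ| =
      ((nT u + ξ) 0)⁻¹ ^ Module.finrank ℝ (fiberTangent X nT u ξ) *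
        absCurvature X u (normalize (nT u + ξ)) := by
  have hν := hnT.isFutureUnit hu
  have hpos : 0 < (nT u + ξ) 0 := hν.time_pos hξ
  have hSν : ∀ y ∈ splitTangent X nT u ξ, form n (nT u) y = 0 :=
    fun y hy => (form_splitTangent hnT hu hξ hy).1
  have hScompl := isCompl_orthogonal hν.unit hSν
  have hbij := canonicalIdent_bijective hX hnT hu hξ
  set c := ((nT u + ξ) 0)⁻¹ with hc
  set L := -(orthProj (splitTangent X nT u ξ) ∘ₗ
      (fderiv ℝ (lightconeGauss nT) (u, ξ)).toLinearMap ∘ₗ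
      (bundleTangent X nT u ξ).subtype ∘ₗ canonicalIdentInv X nT u ξ) with hL
  -- the preimage of `y` under the canonical identification
  have hinv : ∀ y : splitTangent X nT u ξ, (y : Mink n) =
      fderiv ℝ X u (canonicalIdentInv X nT u ξ y).1.1 +
        orthProj (fiberTangent X nT u ξ) (canonicalIdentInv X nT u ξ y).1.2 := by
    intro y
    rw [← canonicalIdent_apply hnT hu hξ]
    congr 1
    rw [canonicalIdentInv, dif_pos hbij]
    exact ((LinearEquiv.ofBijective _ hbij).apply_symm_apply y).symm
  have hform : ∀ z ∈ splitTangent X nT u ξ, ∀ y, form n z (L y) =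
      -(c * (form n z (fderiv ℝ nT u (canonicalIdentInv X nT u ξ y).1.1) +
        form n z (canonicalIdentInv X nT u ξ y).1.2)) := by
    intro z hz y
    obtain ⟨r, hr⟩ := fderiv_lightconeGauss hX hnT hu hpos.ne'
      (canonicalIdentInv X nT u ξ y).1
    have h1 : (L y : Mink n) = -(orthProj (splitTangent X nT u ξ)
      (fderiv ℝ (lightconeGauss nT) (u, ξ) (canonicalIdentInv X nT u ξ y).1) : Mink n) := rfl
    rw [h1, map_neg, form_orthProj hScompl hz, hr]
    have h2 := form_splitTangent hnT hu hξ hz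
    simp only [map_add, map_smul, form_comm z (nT u), form_comm z ξ, h2.1, h2.2, smul_eq_mul]
    ring
  have hTS : ∀ i, partialDeriv X i u ∈ splitTangent X nT u ξ := fun i =>
    Submodule.mem_sup_left (Submodule.subset_span (Set.mem_range_self i))
  have hFS : fiberTangent X nT u ξ ≤ splitTangent X nT u ξ := le_sup_right
  have hTform : ∀ i y, form n (partialDeriv X i u) (L y) =
      form n (normalize (nT u + ξ))
        (fderiv ℝ (partialDeriv X i) u (canonicalIdentInv X nT u ξ y).1.1) := by
    intro i y
    rw [hform _ (hTS i), form_comm _ (fderiv ℝ nT u _), hnT.form_fderiv hX hu,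
      (form_of_mem_bundleTangent hX hnT hu (canonicalIdentInv X nT u ξ y).2).2.2 i, normalize,
      map_smul, LinearMap.smul_apply, map_add, LinearMap.add_apply, smul_eq_mul]
    ring
  have hw : ∀ (y : splitTangent X nT u ξ) (w : Param s) (f : Mink n),
      f ∈ fiberTangent X nT u ξ → (y : Mink n) = fderiv ℝ X u w + f →
      (canonicalIdentInv X nT u ξ y).1.1 = w ∧
        (orthProj (fiberTangent X nT u ξ) (canonicalIdentInv X nT u ξ y).1.2 : Mink n) = f := by
    intro y w f hf hy
    obtain ⟨h1, h2⟩ := components_eq hnT hu (fderiv_apply_mem_tangentSpace X u _)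
      (fderiv_apply_mem_tangentSpace X u w) (Subtype.mem _) hf ((hinv y).symm.trans hy)
    exact ⟨hX.immersive u hu h1, h2⟩
  have hwF : ∀ y : splitTangent X nT u ξ, (y : Mink n) ∈ fiberTangent X nT u ξ →
      (canonicalIdentInv X nT u ξ y).1.1 = 0 ∧
        (orthProj (fiberTangent X nT u ξ) (canonicalIdentInv X nT u ξ y).1.2 : Mink n) = y :=
    fun y hy => hw y 0 y hy (by rw [map_zero, zero_add])
  have key := abs_det_of_adapted hν.unit (hX.linearIndependent hu) (F := fiberTangent X nT u ξ)
    (S := splitTangent X nT u ξ) rfl hSν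
    (fun i y hy => form_tangentSpace_fiberTangent (Submodule.subset_span (Set.mem_range_self i)) hy)
    L (-c) (secondForm X u (normalize (nT u + ξ))) ?_ ?_ ?_
  · rw [lipschitzKilling, ← hL, key, abs_neg, abs_of_pos (inv_pos.2 hpos)]
    rfl
  · intro i y j hy
    rw [hTform, (hw y (EuclideanSpace.single j 1) 0 (Submodule.zero_mem _)
      (by rw [add_zero]; exact hy)).1]
    rfl
  · intro i y hy
    rw [hTform, (hwF y hy).1, map_zero, map_zero]
  · intro z hz y hy
    rw [hform z (hFS hz), (hwF y hy).1, map_zero, map_zero, zero_add,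
      ← form_orthProj (isCompl_fiberTangent hnT hu) hz, (hwF y hy).2]
    ring

theorem finrank_spacelikeNormalSpace (hX : IsSpacelikeEmbedding U X)
    (hnT : IsFutureUnitTimelikeNormal U X nT) (hu : u ∈ U) {k : ℕ} (hk : s + k = n + 1) :
    Module.finrank ℝ (spacelikeNormalSpace X nT u) = k - 1 := by
  have h1 := finrank_sup_span_singleton_of_orthogonal (W := tangentSpace X u) (x := nT u)
    (by rw [hnT.unit u hu]; norm_num) (fun w hw => hnT.normal u hu w hw)
  have h2 := finrank_orthogonal_add (tangentSpace X u ⊔ Submodule.span ℝ {nT u})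
  rw [orthogonal_sup_span_singleton, h1, hX.finrank_tangentSpace hu] at h2
  change Module.finrank ℝ (spacelikeNormalSpace X nT u) + (s + 1) = n + 1 at h2
  omega

theorem finrank_fiberTangent (hX : IsSpacelikeEmbedding U X)
    (hnT : IsFutureUnitTimelikeNormal U X nT) (hu : u ∈ U) (hξ : ξ ∈ fiber X nT u) {k : ℕ}
    (hk : s + k = n + 1) : Module.finrank ℝ (fiberTangent X nT u ξ) = k - 1 - 1 := by
  have hξν := mem_spacelikePart.1 hξ.1
  have h1 := finrank_sup_span_singleton_of_orthogonal (W := tangentSpace X u) (x := nT u)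
    (by rw [hnT.unit u hu]; norm_num) (fun w hw => hnT.normal u hu w hw)
  have h2 := finrank_sup_span_singleton_of_orthogonal
    (W := tangentSpace X u ⊔ Submodule.span ℝ {nT u}) (x := ξ) (by rw [hξ.2]; norm_num)
    fun w hw => by
      obtain ⟨a, ha, b, hb, rfl⟩ := Submodule.mem_sup.1 hw
      obtain ⟨c, rfl⟩ := Submodule.mem_span_singleton.1 hb
      have h : form n a ξ = 0 := hξν.1 a ha
      rw [map_add, LinearMap.add_apply, h, map_smul, LinearMap.smul_apply, hξν.2, smul_zero,
        add_zero]
  have h3 := finrank_orthogonal_add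
    (tangentSpace X u ⊔ Submodule.span ℝ {nT u} ⊔ Submodule.span ℝ {ξ})
  rw [orthogonal_sup_span_singleton, orthogonal_sup_span_singleton, h2, h1,
    hX.finrank_tangentSpace hu] at h3
  change Module.finrank ℝ (fiberTangent X nT u ξ) + (s + 1 + 1) = n + 1 at h3
  omega

end Curvature

section TotalCurvature

variable {s n : ℕ} {U : Set (Param s)} {X nT : Param s → Mink n} {u : Param s}

theorem continuous_absCurvature (X : Param s → Mink n) (u : Param s) :
    Continuous (absCurvature X u) := by
  have h : Continuous (secondForm X u) := continuous_matrix fun i j =>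
    LinearMap.continuous_of_finiteDimensional ((form n).flip
      (fderiv ℝ (partialDeriv X i) u (EuclideanSpace.single j 1)))
  exact (h.matrix_det.div_const _).abs

theorem integrableOn_abs_lipschitzKilling (hX : IsSpacelikeEmbedding U X)
    (hnT : IsFutureUnitTimelikeNormal U X nT) (hu : u ∈ U) {k : ℕ} (hk : s + k = n + 1) :
    IntegrableOn (fun ξ => |lipschitzKilling X nT u ξ|) (fiber X nT u)
      (fiberMeasure k X nT u) := by
  obtain ⟨f, hf, hmeas⟩ := exists_sphereMeasure_eq (exists_orthonormalFrame (hnT.unit u hu)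
    (W := spacelikeNormalSpace X nT u) (fun w hw => (mem_spacelikePart.1 hw).2)
    (finrank_spacelikeNormalSpace hX hnT hu hk))
  have hmem : ∀ x, sphereParam f x ∈ fiber X nT u := fun x => by
    rw [fiber_eq]
    exact hf.range_sphereParam ▸ Set.mem_range_self x
  rw [fiberMeasure, hmeas, hf.measurableEmbedding_sphereParam.integrableOn_map_iff]
  apply Integrable.integrableOn
  have heq : (fun ξ => |lipschitzKilling X nT u ξ|) ∘ sphereParam f = fun x =>
      ((nT u + sphereParam f x) 0)⁻¹ ^ (k - 1 - 1) *
        absCurvature X u (normalize (nT u + sphereParam f x)) := by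
    funext x
    rw [Function.comp_apply, abs_lipschitzKilling hX hnT hu (hmem x),
      finrank_fiberTangent hX hnT hu (hmem x) hk]
  have h1 : Continuous fun x => nT u + sphereParam f x :=
    continuous_const.add (continuous_sphereParam f)
  have h2 : Continuous fun x => ((nT u + sphereParam f x) 0)⁻¹ :=
    ((continuous_apply 0).comp h1).inv₀ fun x =>
      ((hnT.isFutureUnit hu).time_pos (hmem x)).ne'
  have hcont : Continuous ((fun ξ => |lipschitzKilling X nT u ξ|) ∘ sphereParam f) := by
    rw [heq]
    exact (h2.pow _).mul ((continuous_absCurvature X u).comp (h2.smul h1))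
  exact hcont.integrable_of_hasCompactSupport (HasCompactSupport.of_compactSpace _)

theorem setIntegral_abs_lipschitzKilling {nT' : Param s → Mink n}
    (hX : IsSpacelikeEmbedding U X) (hnT : IsFutureUnitTimelikeNormal U X nT)
    (hnT' : IsFutureUnitTimelikeNormal U X nT') (hu : u ∈ U) {k : ℕ} (hk : s + k = n + 1)
    {A : Set (Mink n)} (hA : A ⊆ fiber X nT u) (hAm : MeasurableSet A) :
    ∫ ξ in A, |lipschitzKilling X nT u ξ| ∂(fiberMeasure k X nT u) =
      ∫ ξ in transition (nT u) (nT' u) '' A, |lipschitzKilling X nT' u ξ|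
        ∂(fiberMeasure k X nT' u) := by
  obtain ⟨f, hf, hmeas⟩ := exists_sphereMeasure_eq (exists_orthonormalFrame (hnT.unit u hu)
    (W := spacelikeNormalSpace X nT u) (fun w hw => (mem_spacelikePart.1 hw).2)
    (finrank_spacelikeNormalSpace hX hnT hu hk))
  obtain ⟨f', hf', hmeas'⟩ := exists_sphereMeasure_eq (exists_orthonormalFrame (hnT'.unit u hu)
    (W := spacelikeNormalSpace X nT' u) (fun w hw => (mem_spacelikePart.1 hw).2)
    (finrank_spacelikeNormalSpace hX hnT' hu hk))
  have hν := hnT.isFutureUnit hu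
  have hν' := hnT'.isFutureUnit hu
  rw [fiberMeasure, fiberMeasure, hmeas, hmeas']
  refine setIntegral_transition hν hν' (hnT.normal u hu) (hnT'.normal u hu) hf hf' ?_ hA hAm
  intro ξ hξ
  have hξ' : transition (nT u) (nT' u) ξ ∈ fiber X nT' u :=
    transition_mem hν hν' (hnT.normal u hu) (hnT'.normal u hu) hξ
  rw [abs_lipschitzKilling hX hnT hu hξ, abs_lipschitzKilling hX hnT' hu hξ',
    finrank_fiberTangent hX hnT hu hξ hk, finrank_fiberTangent hX hnT' hu hξ' hk,
    normalize_add_transition hν hν' hξ, inv_time_add_transition, mul_pow, inv_pow (-_), mul_assoc,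
    inv_mul_cancel_left₀ (pow_ne_zero _ (hν.neg_form_pos hν' hξ).ne')]

theorem measurableSet_fiber (X nT : Param s → Mink n) (u : Param s) :
    MeasurableSet (fiber X nT u) := by
  have h1 : IsClosed (spacelikeNormalSpace X nT u : Set (Mink n)) :=
    Submodule.closed_of_finiteDimensional _
  have h2 : Continuous fun ξ : Mink n => form n ξ ξ := by
    simp only [form_apply]; fun_prop
  exact h1.measurableSet.inter (h2.measurable (measurableSet_singleton 1))

end TotalCurvature

end LorentzMinkowski

theorem lemma6p2 (s k n : ℕ) (hk : s + k = n + 1)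
    (U : Set (LorentzMinkowski.Param s)) (X : LorentzMinkowski.Param s → LorentzMinkowski.Mink n)
    (hX : LorentzMinkowski.IsSpacelikeEmbedding U X)
    (nT nT' : LorentzMinkowski.Param s → LorentzMinkowski.Mink n)
    (hnT : LorentzMinkowski.IsFutureUnitTimelikeNormal U X nT)
    (hnT' : LorentzMinkowski.IsFutureUnitTimelikeNormal U X nT')
    (u : LorentzMinkowski.Param s) (hu : u ∈ U) :
    (∃ Φ : LorentzMinkowski.Mink n → LorentzMinkowski.Mink n,
      Set.BijOn Φ (LorentzMinkowski.fiber X nT u) (LorentzMinkowski.fiber X nT' u) ∧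
      (∀ ξ ∈ LorentzMinkowski.fiber X nT u,
        LorentzMinkowski.lightconeGauss nT' (u, Φ ξ) =
          LorentzMinkowski.lightconeGauss nT (u, ξ)) ∧
      ∀ A ⊆ LorentzMinkowski.fiber X nT u, MeasurableSet A →
        ∫ ξ in A, |LorentzMinkowski.lipschitzKilling X nT u ξ|
            ∂(LorentzMinkowski.fiberMeasure k X nT u) =
          ∫ ξ in Φ '' A, |LorentzMinkowski.lipschitzKilling X nT' u ξ|
            ∂(LorentzMinkowski.fiberMeasure k X nT' u)) ∧
    MeasureTheory.IntegrableOn (fun ξ => |LorentzMinkowski.lipschitzKilling X nT u ξ|)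
      (LorentzMinkowski.fiber X nT u) (LorentzMinkowski.fiberMeasure k X nT u) ∧
    MeasureTheory.IntegrableOn (fun ξ => |LorentzMinkowski.lipschitzKilling X nT' u ξ|)
      (LorentzMinkowski.fiber X nT' u) (LorentzMinkowski.fiberMeasure k X nT' u) ∧
    LorentzMinkowski.totalAbsCurvature k X nT u =
      LorentzMinkowski.totalAbsCurvature k X nT' u := by
  have hν := hnT.isFutureUnit hu
  have hν' := hnT'.isFutureUnit hu
  have hbij := LorentzMinkowski.bijOn_transition hν hν' (hnT.normal u hu) (hnT'.normal u hu)
  refine ⟨⟨_, hbij, fun ξ hξ => LorentzMinkowski.normalize_add_transition hν hν' hξ,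
    fun A hA hAm => LorentzMinkowski.setIntegral_abs_lipschitzKilling hX hnT hnT' hu hk hA hAm⟩,
    LorentzMinkowski.integrableOn_abs_lipschitzKilling hX hnT hu hk,
    LorentzMinkowski.integrableOn_abs_lipschitzKilling hX hnT' hu hk, ?_⟩
  rw [LorentzMinkowski.totalAbsCurvature, LorentzMinkowski.totalAbsCurvature,
    LorentzMinkowski.setIntegral_abs_lipschitzKilling hX hnT hnT' hu hk subset_rfl
      (LorentzMinkowski.measurableSet_fiber X nT u)]
  exact congrArg (fun S => ∫ ξ in S, |LorentzMinkowski.lipschitzKilling X nT' u ξ|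
    ∂(LorentzMinkowski.fiberMeasure k X nT' u)) hbij.image_eq
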